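/- **Lemma (Poincaré–trace inequality).** Let $d\ge 1$ and let $D\subset\mathbb R^d$ be a bounded domain (nonempty, open, connected) with smooth boundary $\partial D$. Let $\|\cdot\|_D$ and $\|\cdot\|_{\partial D}$ denote the norms of $L^2(D)$ and of $L^2(\partial D)$ with respect to the surface measure (the $(d-1)$-dimensional Hausdorff measure; counting measure if $d=1$), and on $\partial D$ let $u\in H^1(D)$ stand for its trace. For $\theta\ge 0$ consider the inequality $$C\,\|u\|_D^2\;\le\;\|\nabla u\|_D^2+\theta\,\|u\|_{\partial D}^2\qquad\text{for all } u\in H^1(D).\tag{1}$$ 1. For every $\theta\ge 0$ there is an optimal (that is, largest) real constant $C^*_\theta$ such that (1) holds with $C=C^*_\theta$. One has $C^*_\theta>0$ for every $\theta>0$ and $C^*_0=0$, and the function $\theta\mapsto C^*_\theta$ is continuous and non-decreasing on $[0,\infty)$. 2. Let $R=\tfrac12\operatorname{diam}(D)$. For every $\theta\ge0$, inequality (1) also holds with $C=C_\theta$, where $$C_\theta=\begin{cases}\theta\left(\dfrac dR-\theta\right), & 0\le\theta<\dfrac d{2R},\\[2mm] \dfrac{d^2}{4R^2}, & \theta\ge\dfrac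 d{2R}.\end{cases}$$ -/

import Mathlib

open MeasureTheory Filter Topology
open scoped ContDiff

namespace PoincareTrace

/-- `D` is an open set whose boundary is a smooth hypersurface with `D` lying locally on one side
of it: near every boundary point `D` is the sublevel set of a smooth function with nonvanishing
derivative at that point. -/
def HasSmoothBoundary {d : ℕ} (D : Set (EuclideanSpace ℝ (Fin d))) : Prop :=
  ∀ x ∈ frontier D, ∃ U ∈ 𝓝 x, ∃ ρ : EuclideanSpace ℝ (Fin d) → ℝ,
    ContDiff ℝ ∞ ρ ∧ fderiv ℝ ρ x ≠ 0 ∧ ∀ y ∈ U, y ∈ D ↔ ρ y < 0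

/-- A bounded domain (nonempty, connected, open set) with smooth boundary. -/
structure IsSmoothBoundedDomain {d : ℕ} (D : Set (EuclideanSpace ℝ (Fin d))) : Prop where
  isOpen : IsOpen D
  isConnected : IsConnected D
  isBounded : Bornology.IsBounded D
  smooth : HasSmoothBoundary D

/-- The Lebesgue measure on `D`. -/
noncomputable def interiorMeasure {d : ℕ} (D : Set (EuclideanSpace ℝ (Fin d))) :
    Measure (EuclideanSpace ℝ (Fin d)) :=
  volume.restrict D

/-- The surface measure `dS` on `∂D`: the `(d - 1)`-dimensional Hausdorff measure, in the Euclidean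
normalization (for `d = 1` the counting measure), restricted to `∂D`. -/
noncomputable def surfaceMeasure {d : ℕ} (D : Set (EuclideanSpace ℝ (Fin d))) :
    Measure (EuclideanSpace ℝ (Fin d)) :=
  (μHE[d - 1] : Measure (EuclideanSpace ℝ (Fin d))).restrict (frontier D)

/-- `G` is a weak gradient of `u` on `D`, tested against `C_c^∞(D)` in all directions `v`. -/
def IsWeakGradient {d : ℕ} (D : Set (EuclideanSpace ℝ (Fin d)))
    (u : EuclideanSpace ℝ (Fin d) → ℝ)
    (G : EuclideanSpace ℝ (Fin d) → EuclideanSpace ℝ (Fin d)) : Prop :=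
  ∀ φ : EuclideanSpace ℝ (Fin d) → ℝ, ContDiff ℝ ∞ φ → HasCompactSupport φ → tsupport φ ⊆ D →
    ∀ v : EuclideanSpace ℝ (Fin d),
      ∫ x in D, u x * fderiv ℝ φ x v = -∫ x in D, inner ℝ (G x) v * φ x

/-- `u ∈ H¹(D)`: `u ∈ L²(D)` has a weak gradient in `L²(D; ℝ^d)`. -/
def MemH1 {d : ℕ} (D : Set (EuclideanSpace ℝ (Fin d))) (u : EuclideanSpace ℝ (Fin d) → ℝ) : Prop :=
  MemLp u 2 (interiorMeasure D) ∧
    ∃ G : EuclideanSpace ℝ (Fin d) → EuclideanSpace ℝ (Fin d),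
      MemLp G 2 (interiorMeasure D) ∧ IsWeakGradient D u G

open Classical in
/-- The weak gradient `∇u ∈ L²(D; ℝ^d)` of `u ∈ H¹(D)` (unique up to a null subset of `D`). -/
noncomputable def weakGradient {d : ℕ} (D : Set (EuclideanSpace ℝ (Fin d)))
    (u : EuclideanSpace ℝ (Fin d) → ℝ) : EuclideanSpace ℝ (Fin d) → EuclideanSpace ℝ (Fin d) :=
  if h : ∃ G : EuclideanSpace ℝ (Fin d) → EuclideanSpace ℝ (Fin d),
      MemLp G 2 (interiorMeasure D) ∧ IsWeakGradient D u G
  then h.choose else 0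

/-- `g ∈ L²(∂D)` is the trace of `u ∈ H¹(D)`: there are `φ_n ∈ C^∞` (up to the boundary) with
`φ_n → u` in `H¹(D)` and `φ_n|_∂D → g` in `L²(∂D)`. -/
def IsTrace {d : ℕ} (D : Set (EuclideanSpace ℝ (Fin d)))
    (u g : EuclideanSpace ℝ (Fin d) → ℝ) : Prop :=
  MemLp g 2 (surfaceMeasure D) ∧
    ∃ φ : ℕ → EuclideanSpace ℝ (Fin d) → ℝ, (∀ n, ContDiff ℝ ∞ (φ n)) ∧
      Tendsto (fun n => eLpNorm (fun x => φ n x - u x) 2 (interiorMeasure D)) atTop (𝓝 0) ∧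
      Tendsto (fun n => eLpNorm (fun x => gradient (φ n) x - weakGradient D u x) 2
        (interiorMeasure D)) atTop (𝓝 0) ∧
      Tendsto (fun n => eLpNorm (fun x => φ n x - g x) 2 (surfaceMeasure D)) atTop (𝓝 0)

open Classical in
/-- The trace operator `u ↦ u|_∂D ∈ L²(∂D)` on `H¹(D)` (unique up to a null subset of `∂D`;
for a bounded smooth domain every `u ∈ H¹(D)` has a trace). -/
noncomputable def trace {d : ℕ} (D : Set (EuclideanSpace ℝ (Fin d)))
    (u : EuclideanSpace ℝ (Fin d) → ℝ) : EuclideanSpace ℝ (Fin d) → ℝ :=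
  if h : ∃ g : EuclideanSpace ℝ (Fin d) → ℝ, IsTrace D u g then h.choose else 0

/-- The constant `C` fulfils
`C ‖u‖²_D ≤ ‖∇u‖²_D + θ ‖u‖²_∂D` for all `u ∈ H¹(D)`. -/
def PoincareTraceInequality {d : ℕ} (D : Set (EuclideanSpace ℝ (Fin d))) (θ C : ℝ) : Prop :=
  ∀ u : EuclideanSpace ℝ (Fin d) → ℝ, MemH1 D u →
    C * ∫ x, u x ^ 2 ∂(interiorMeasure D) ≤
      ∫ x, ‖weakGradient D u x‖ ^ 2 ∂(interiorMeasure D) +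
        θ * ∫ x, trace D u x ^ 2 ∂(surfaceMeasure D)

/-- The explicit constant `C_θ` in dimension `d` for the radius `R`. -/
noncomputable def explicitConstant (d : ℕ) (R θ : ℝ) : ℝ :=
  if θ < d / (2 * R) then θ * (d / R - θ) else d ^ 2 / (4 * R ^ 2)

end PoincareTrace

/-!
The explicit inequality is a weighted isoperimetric inequality in disguise. Let `R = diam D / 2`.
If `A` has diameter at most `2 R`, then every point `(1 + ε/2) x - (ε/2) y` with `x, y ∈ A` is within
`ε R` of `x`, so the `ε R`-neighbourhood of `A` contains `(1 + ε/2) A + (ε/2) (-A)` and, by the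
Brunn–Minkowski inequality, has volume at least `(1 + ε) ^ d` times that of `A`
(`mul_volume_le_of_diam_le`). It is the use of `-A`, which has the same volume as `A`, that allows
half the diameter in place of the circumradius. Applying this to the superlevel sets in `D` of a
smooth `f ≥ 0` and letting `ε → 0` yields
`d ∫_D f ≤ R (∫_D |∇f| + ∫_∂D f dS)` (`IsSmoothBoundedDomain.mul_integral_le`); the boundary term
appears because the outer layer of width `r` has mass at most `r ∫_∂D f dS` up to higher order terms
(`IsSmoothBoundedDomain.lintegral_outerLayer_le`), as one sees in charts where `∂D` is a graph with
small Lipschitz constant. For `f = φ²`, Young's inequality `2 t |φ| |∇φ| ≤ t² φ² + |∇φ|²` turns this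
into `t (d/R - t) ‖φ‖²_D ≤ ‖∇φ‖²_D + t ‖φ‖²_∂D`, and `t = min θ (d/(2R))` gives the explicit constant
for smooth `φ`.

To pass to `H¹(D)`, smooth functions are shown to be dense (`IsWeakGradient.isSmoothLimit`): in a
boundary chart one mollifies with a kernel concentrated on one side, which only reads values of the
function inside `D`. Together with the trace inequality for smooth functions
(`IsSmoothBoundedDomain.exists_lintegral_surfaceMeasure_le`) density gives every `u ∈ H¹(D)` a trace
(`MemH1.exists_isTrace`), and inequalities for smooth functions carry over
(`IsSmoothBoundedDomain.poincareTraceInequality_of_smooth`).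

The admissible constants for a given `θ` form a closed set, which contains `0` and is bounded above
by the value for `u = 1`; the optimal constant is its maximum. It is positive for `θ > 0` because the
explicit constant is. It is nondecreasing in `θ`, vanishes at `θ = 0`, and satisfies
`s C*(θ) ≤ C*(s θ)` for `0 ≤ s ≤ 1`; these facts and `C*(θ) ≤ K θ` make it Lipschitz.
-/

namespace PoincareTrace

open scoped Pointwise ENNReal NNReal

/-! ### The Prékopa–Leindler inequality -/

/-- The translates `l + K` and `m + L`, with `l` the least point of `L` and `m` the greatest point
of `K`, meet in at most one point and both lie in `C`. -/
theorem volume_add_volume_le_of_compact {K L C : Set ℝ} (hK : IsCompact K) (hL : IsCompact L)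
    (hK' : K.Nonempty) (hL' : L.Nonempty) (h : ∀ x ∈ K, ∀ y ∈ L, x + y ∈ C) :
    volume K + volume L ≤ volume C := by
  set m := sSup K
  set l := sInf L
  have hm : m ∈ K := hK.sSup_mem hK'
  have hl : l ∈ L := hL.sInf_mem hL'
  set S := (fun x => l + x) '' K
  set T := (fun y => m + y) '' L
  have hS : volume S = volume K := by simp [S]
  have hT : volume T = volume L := by simp [T]
  have hTm : MeasurableSet T := (hL.image (by fun_prop)).measurableSet
  have hsub : S ∪ T ⊆ C := by
    rintro z (⟨x, hx, rfl⟩ | ⟨y, hy, rfl⟩)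
    · simpa [add_comm] using h x hx l hl
    · exact h m hm y hy
  have hint : S ∩ T ⊆ {l + m} := by
    rintro z ⟨⟨x, hx, rfl⟩, ⟨y, hy, hxy⟩⟩
    have h1 : x ≤ m := le_csSup hK.bddAbove hx
    have h2 : l ≤ y := csInf_le hL.bddBelow hy
    simp only [Set.mem_singleton_iff] at hxy ⊢
    linarith
  have h0 : volume (S ∩ T) = 0 := measure_mono_null hint (by simp)
  calc volume K + volume L = volume (S ∪ T) + volume (S ∩ T) := by
        rw [measure_union_add_inter S hTm, hS, hT]
    _ = volume (S ∪ T) := by rw [h0, add_zero]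
    _ ≤ volume C := measure_mono hsub

/-- The one-dimensional Brunn–Minkowski inequality. -/
theorem volume_add_volume_le {A B C : Set ℝ} (hA : MeasurableSet A) (hB : MeasurableSet B)
    (hA' : A.Nonempty) (hB' : B.Nonempty) (h : ∀ x ∈ A, ∀ y ∈ B, x + y ∈ C) :
    volume A + volume B ≤ volume C := by
  obtain ⟨a, ha⟩ := hA'
  obtain ⟨b, hb⟩ := hB'
  rw [hA.measure_eq_iSup_isCompact, hB.measure_eq_iSup_isCompact]
  simp only [iSup_and']
  refine ENNReal.biSup_add_biSup_le' ⟨∅, by simp⟩ ⟨∅, by simp⟩ ?_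
  rintro K ⟨hKA, hK⟩ L ⟨hLB, hL⟩
  calc volume K + volume L ≤ volume (insert a K) + volume (insert b L) := by
        gcongr <;> exact Set.subset_insert _ _
    _ ≤ volume C := volume_add_volume_le_of_compact (hK.insert a) (hL.insert b)
        (Set.insert_nonempty _ _) (Set.insert_nonempty _ _)
        fun x hx y hy => h x (Set.insert_subset ha hKA hx) y (Set.insert_subset hb hLB hy)

theorem volume_convexCombination_le {A B C : Set ℝ} {a b : ℝ} (ha : 0 < a) (hb : 0 < b)
    (hA : MeasurableSet A) (hB : MeasurableSet B)
    (hA' : A.Nonempty) (hB' : B.Nonempty) (h : ∀ x ∈ A, ∀ y ∈ B, a * x + b * y ∈ C) :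
    ENNReal.ofReal a * volume A + ENNReal.ofReal b * volume B ≤ volume C := by
  have := volume_add_volume_le (A := a • A) (B := b • B) (C := C) (hA.const_smul₀ a)
    (hB.const_smul₀ b) (hA'.smul_set) (hB'.smul_set) (by
      rintro _ ⟨x, hx, rfl⟩ _ ⟨y, hy, rfl⟩
      exact h x hx y hy)
  simpa [Measure.addHaar_smul, abs_of_pos ha, abs_of_pos hb] using this

/-- Layer-cake formula for functions with values in `[0, 1]`. -/
theorem lintegral_eq_lintegral_Ioo_of_le_one {α : Type*} [MeasurableSpace α] (μ : Measure α)
    {f : α → ℝ≥0∞} (hf : Measurable f) (h1 : ∀ x, f x ≤ 1) :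
    ∫⁻ x, f x ∂μ = ∫⁻ t in Set.Ioo (0 : ℝ) 1, μ {x | ENNReal.ofReal t < f x} := by
  have hfin : ∀ x, f x ≠ ⊤ := fun x => ((h1 x).trans_lt ENNReal.one_lt_top).ne
  have h := lintegral_eq_lintegral_meas_lt (f := fun x => (f x).toReal) μ
    (Eventually.of_forall fun x => ENNReal.toReal_nonneg) hf.ennreal_toReal.aemeasurable
  simp only [ENNReal.ofReal_toReal (hfin _)] at h
  rw [h, ← Set.Ioo_union_Ici_eq_Ioi (zero_lt_one' ℝ), lintegral_union measurableSet_Ici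
    (Set.disjoint_left.2 fun x hx hx' => absurd hx.2 (not_lt.2 hx'))]
  have h0 : ∫⁻ t in Set.Ici (1 : ℝ), μ {x | t < (f x).toReal} = 0 := by
    rw [setLIntegral_congr_fun (g := fun _ => 0) measurableSet_Ici, lintegral_zero]
    intro t ht
    have : {x | t < (f x).toReal} = ∅ := by
      ext x
      have : (f x).toReal ≤ 1 := by simpa using ENNReal.toReal_mono ENNReal.one_ne_top (h1 x)
      simp only [Set.mem_ofPred_eq, Set.mem_empty_iff_false, iff_false, not_lt]
      exact this.trans ht
    simp [this]
  rw [h0, add_zero]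
  refine setLIntegral_congr_fun measurableSet_Ioo fun t ht => ?_
  have : ∀ x, t < (f x).toReal ↔ ENNReal.ofReal t < f x := fun x => by
    rw [ENNReal.ofReal_lt_iff_lt_toReal ht.1.le (hfin x)]
  simp only [this]

theorem lintegral_Ioo_le_lintegral {α : Type*} [MeasurableSpace α] (μ : Measure α)
    {f : α → ℝ≥0∞} (hf : Measurable f) :
    ∫⁻ t in Set.Ioo (0 : ℝ) 1, μ {x | ENNReal.ofReal t < f x} ≤ ∫⁻ x, f x ∂μ := by
  calc ∫⁻ t in Set.Ioo (0 : ℝ) 1, μ {x | ENNReal.ofReal t < f x}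
      = ∫⁻ t in Set.Ioo (0 : ℝ) 1, μ {x | ENNReal.ofReal t < min (f x) 1} := by
        refine setLIntegral_congr_fun measurableSet_Ioo fun t ht => ?_
        have : ENNReal.ofReal t < 1 := by simpa using ht.2
        simp [this]
    _ = ∫⁻ x, min (f x) 1 ∂μ := (lintegral_eq_lintegral_Ioo_of_le_one μ
        (hf.min measurable_const) fun x => min_le_right _ _).symm
    _ ≤ _ := lintegral_mono fun x => min_le_left _ _

/-- With the suprema normalized to `1`, the superlevel sets of `f` and `g` at each level `t < 1` are
nonempty and combine into the superlevel set of `h`, so the one-dimensional Brunn–Minkowski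
inequality gives even the arithmetic mean of the two integrals as a lower bound. -/
theorem prekopaLeindler_real_of_iSup_eq_one {f g h : ℝ → ℝ≥0∞} {a b : ℝ} (ha : 0 < a) (hb : 0 < b)
    (hab : a + b = 1) (hf : Measurable f) (hg : Measurable g) (hh : Measurable h)
    (hf1 : ⨆ x, f x = 1) (hg1 : ⨆ x, g x = 1)
    (H : ∀ x y, f x ^ a * g y ^ b ≤ h (a * x + b * y)) :
    (∫⁻ x, f x) ^ a * (∫⁻ x, g x) ^ b ≤ ∫⁻ x, h x := by
  have key : ENNReal.ofReal a * (∫⁻ x, f x) + ENNReal.ofReal b * (∫⁻ x, g x) ≤ ∫⁻ x, h x := by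
    have mf : Measurable fun t : ℝ => volume {x | ENNReal.ofReal t < f x} :=
      Antitone.measurable fun s t hst => measure_mono fun x (hx : _ < _) =>
        (ENNReal.ofReal_le_ofReal hst).trans_lt hx
    have mg : Measurable fun t : ℝ => volume {x | ENNReal.ofReal t < g x} :=
      Antitone.measurable fun s t hst => measure_mono fun x (hx : _ < _) =>
        (ENNReal.ofReal_le_ofReal hst).trans_lt hx
    refine le_trans ?_ (lintegral_Ioo_le_lintegral volume hh)
    rw [lintegral_eq_lintegral_Ioo_of_le_one volume hf fun x => hf1 ▸ le_iSup f x,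
      lintegral_eq_lintegral_Ioo_of_le_one volume hg fun x => hg1 ▸ le_iSup g x,
      ← lintegral_const_mul _ mf, ← lintegral_const_mul _ mg, ← lintegral_add_left (by fun_prop)]
    refine setLIntegral_mono' measurableSet_Ioo fun t ht => ?_
    have ht1 : ENNReal.ofReal t < 1 := by simpa using ht.2
    refine volume_convexCombination_le ha hb (measurableSet_lt measurable_const hf)
      (measurableSet_lt measurable_const hg) ?_ ?_ ?_
    · obtain ⟨x, hx⟩ := lt_iSup_iff.1 (hf1.symm ▸ ht1)
      exact ⟨x, hx⟩
    · obtain ⟨x, hx⟩ := lt_iSup_iff.1 (hg1.symm ▸ ht1)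
      exact ⟨x, hx⟩
    · intro x hx y hy
      refine lt_of_lt_of_le ?_ (H x y)
      calc ENNReal.ofReal t = ENNReal.ofReal t ^ a * ENNReal.ofReal t ^ b := by
            rw [← ENNReal.rpow_add _ _ (by simpa using ht.1) ENNReal.ofReal_ne_top, hab,
              ENNReal.rpow_one]
        _ < f x ^ a * g y ^ b :=
          ENNReal.mul_lt_mul (ENNReal.rpow_lt_rpow hx ha) (ENNReal.rpow_lt_rpow hy hb)
  refine le_trans ?_ key
  by_cases hF : ∫⁻ x, f x = ⊤
  · simp [hF, ENNReal.mul_top, ha]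
  by_cases hG : ∫⁻ x, g x = ⊤
  · simp [hG, ENNReal.mul_top, hb]
  lift ∫⁻ x, f x to NNReal using hF with F
  lift ∫⁻ x, g x to NNReal using hG with G
  have := NNReal.geom_mean_le_arith_mean2_weighted ⟨a, ha.le⟩ ⟨b, hb.le⟩ F G
    (NNReal.eq hab)
  rw [← ENNReal.coe_rpow_of_nonneg _ ha.le, ← ENNReal.coe_rpow_of_nonneg _ hb.le,
    ENNReal.ofReal_eq_coe_nnreal ha.le, ENNReal.ofReal_eq_coe_nnreal hb.le]
  exact_mod_cast this

theorem prekopaLeindler_real_of_bounded {f g h : ℝ → ℝ≥0∞} {a b : ℝ} (ha : 0 < a) (hb : 0 < b)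
    (hab : a + b = 1) (hf : Measurable f) (hg : Measurable g) (hh : Measurable h)
    (hf1 : ⨆ x, f x ≠ ⊤) (hg1 : ⨆ x, g x ≠ ⊤)
    (H : ∀ x y, f x ^ a * g y ^ b ≤ h (a * x + b * y)) :
    (∫⁻ x, f x) ^ a * (∫⁻ x, g x) ^ b ≤ ∫⁻ x, h x := by
  set M := ⨆ x, f x
  set N := ⨆ x, g x
  by_cases hM : M = 0
  · have : ∀ x, f x = 0 := fun x => le_zero_iff.1 (hM ▸ le_iSup f x)
    simp [this, ha]
  by_cases hN : N = 0
  · have : ∀ x, g x = 0 := fun x => le_zero_iff.1 (hN ▸ le_iSup g x)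
    simp [this, hb]
  have hMa0 : M ^ a ≠ 0 := by simp [hM, hf1]
  have hMa : M ^ a ≠ ⊤ := by simp [hM, hf1]
  have hNb0 : N ^ b ≠ 0 := by simp [hN, hg1]
  have hNb : N ^ b ≠ ⊤ := by simp [hN, hg1]
  have h1 := prekopaLeindler_real_of_iSup_eq_one (f := fun x => M⁻¹ * f x)
    (g := fun x => N⁻¹ * g x) (h := fun x => ((M ^ a)⁻¹ * (N ^ b)⁻¹) * h x) ha hb hab
    (hf.const_mul _) (hg.const_mul _) (hh.const_mul _)
    (by rw [← ENNReal.mul_iSup]; exact ENNReal.inv_mul_cancel hM hf1)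
    (by rw [← ENNReal.mul_iSup]; exact ENNReal.inv_mul_cancel hN hg1)
    (fun x y => by
      rw [ENNReal.mul_rpow_of_nonneg _ _ ha.le, ENNReal.mul_rpow_of_nonneg _ _ hb.le,
        ENNReal.inv_rpow, ENNReal.inv_rpow, mul_mul_mul_comm]
      gcongr
      exact H x y)
  rw [lintegral_const_mul _ hf, lintegral_const_mul _ hg, lintegral_const_mul _ hh,
    ENNReal.mul_rpow_of_nonneg _ _ ha.le, ENNReal.mul_rpow_of_nonneg _ _ hb.le,
    ENNReal.inv_rpow, ENNReal.inv_rpow, mul_mul_mul_comm] at h1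
  refine (ENNReal.mul_le_mul_iff_right ?_ ?_).1 h1
  · simp only [ne_eq, mul_eq_zero, ENNReal.inv_eq_zero, hMa, hNb, or_self, not_false_iff]
  · exact ENNReal.mul_ne_top (ENNReal.inv_ne_top.2 hMa0) (ENNReal.inv_ne_top.2 hNb0)

/-- The Prékopa–Leindler inequality on the line; truncation reduces it to bounded functions. -/
theorem prekopaLeindler_real {f g h : ℝ → ℝ≥0∞} {a b : ℝ} (ha : 0 < a) (hb : 0 < b)
    (hab : a + b = 1) (hf : Measurable f) (hg : Measurable g) (hh : Measurable h)
    (H : ∀ x y, f x ^ a * g y ^ b ≤ h (a * x + b * y)) :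
    (∫⁻ x, f x) ^ a * (∫⁻ x, g x) ^ b ≤ ∫⁻ x, h x := by
  have lim : ∀ {u : ℝ → ℝ≥0∞}, Measurable u →
      Tendsto (fun n : ℕ => ∫⁻ x, min (u x) n) atTop (𝓝 (∫⁻ x, u x)) := by
    intro u hu
    have h1 : ∀ x, ⨆ n : ℕ, min (u x) n = u x := fun x => by
      rw [← inf_iSup_eq, ENNReal.iSup_natCast, inf_top_eq]
    have hm : Monotone fun (n : ℕ) (x : ℝ) => min (u x) (n : ℝ≥0∞) := fun n m hnm x =>
      min_le_min_left _ (by exact_mod_cast hnm)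
    have h2 := lintegral_iSup (μ := volume) (fun n : ℕ => hu.min measurable_const) hm
    simp only [h1] at h2
    rw [h2]
    exact tendsto_atTop_iSup fun n m hnm => lintegral_mono (hm hnm)
  by_cases hF : ∫⁻ x, f x = 0
  · simp [hF, ha]
  by_cases hG : ∫⁻ x, g x = 0
  · simp [hG, hb]
  refine le_of_tendsto' (ENNReal.Tendsto.mul
    ((ENNReal.continuous_rpow_const (y := a)).continuousAt.tendsto.comp (lim hf)) (Or.inl ?_)
    ((ENNReal.continuous_rpow_const (y := b)).continuousAt.tendsto.comp (lim hg)) (Or.inl ?_))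
    fun n => ?_
  · simp [hF, ha.le, ha]
  · simp [hG, hb.le, hb]
  · refine prekopaLeindler_real_of_bounded ha hb hab (hf.min measurable_const)
      (hg.min measurable_const) hh
      (ne_top_of_le_ne_top (ENNReal.natCast_ne_top n) (iSup_le fun x => min_le_right _ _))
      (ne_top_of_le_ne_top (ENNReal.natCast_ne_top n) (iSup_le fun x => min_le_right _ _))
      fun x y => le_trans ?_ (H x y)
    gcongr <;> exact min_le_left _ _

/-- The Prékopa–Leindler inequality, by induction on the dimension: integrating out all but the
first coordinate turns the hypothesis in dimension `n + 1` into the hypothesis on the line. -/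
theorem prekopaLeindler (n : ℕ) {f g h : (Fin n → ℝ) → ℝ≥0∞} {a b : ℝ} (ha : 0 < a) (hb : 0 < b)
    (hab : a + b = 1) (hf : Measurable f) (hg : Measurable g) (hh : Measurable h)
    (H : ∀ x y, f x ^ a * g y ^ b ≤ h (a • x + b • y)) :
    (∫⁻ x, f x) ^ a * (∫⁻ x, g x) ^ b ≤ ∫⁻ x, h x := by
  induction n with
  | zero =>
    have : ∀ u : (Fin 0 → ℝ) → ℝ≥0∞, ∫⁻ x, u x = u 0 := fun u => by
      rw [volume_pi, Measure.pi_of_empty _ 0, lintegral_dirac]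
    simpa only [this, smul_zero, add_zero] using H 0 0
  | succ n ih =>
    set e := (MeasurableEquiv.piFinSuccAbove (fun _ : Fin (n + 1) => ℝ) 0).symm
    have he : MeasurePreserving e := (volume_preserving_piFinSuccAbove _ 0).symm
    have hint : ∀ {u : (Fin (n + 1) → ℝ) → ℝ≥0∞}, Measurable u →
        ∫⁻ x, u x = ∫⁻ s : ℝ, ∫⁻ p : Fin n → ℝ, u (e (s, p)) := fun {u} hu => by
      rw [← he.lintegral_comp_emb e.measurableEmbedding, Measure.volume_eq_prod, lintegral_prod]
      exact (hu.comp e.measurable).aemeasurable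
    have hmeas : ∀ {u : (Fin (n + 1) → ℝ) → ℝ≥0∞}, Measurable u →
        Measurable fun s : ℝ => ∫⁻ p : Fin n → ℝ, u (e (s, p)) := fun {u} hu =>
      (hu.comp e.measurable).lintegral_prod_right'
    rw [hint hf, hint hg, hint hh]
    refine prekopaLeindler_real ha hb hab (hmeas hf) (hmeas hg) (hmeas hh) fun s t => ?_
    refine ih (f := fun p => f (e (s, p))) (g := fun p => g (e (t, p)))
      (h := fun p => h (e (a * s + b * t, p))) (hf.comp (by fun_prop)) (hg.comp (by fun_prop))
      (hh.comp (by fun_prop)) fun p q => ?_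
    have : e (a * s + b * t, a • p + b • q) = a • e (s, p) + b • e (t, q) := by
      simp only [e, MeasurableEquiv.piFinSuccAbove_symm_apply]
      ext i
      refine Fin.cases ?_ (fun j => ?_) i <;> simp
    simpa [this] using H (e (s, p)) (e (t, q))

/-! ### Inflation of a set by its own reflection -/

/-- The Brunn–Minkowski inequality for a set `A` and its reflection `-A`, which have the same
volume. -/
theorem volume_le_of_convexCombination_neg {d : ℕ} {A B : Set (EuclideanSpace ℝ (Fin d))}
    (hA : MeasurableSet A) (hB : MeasurableSet B) {a b : ℝ} (ha : 0 < a) (hb : 0 < b)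
    (hab : a + b = 1) (h : ∀ x ∈ A, ∀ y ∈ A, a • x - b • y ∈ B) : volume A ≤ volume B := by
  have hT := EuclideanSpace.volume_preserving_symm_measurableEquiv_toLp (Fin d)
  have key : ∀ S : Set (EuclideanSpace ℝ (Fin d)), MeasurableSet S →
      ∫⁻ x : Fin d → ℝ, S.indicator 1 (WithLp.toLp 2 x) = volume S := fun S hS => by
    have := hT.symm.lintegral_comp_emb (MeasurableEquiv.measurableEmbedding _) (S.indicator 1)
    rw [lintegral_indicator_one hS] at this
    exact this
  have hmeas : ∀ S : Set (EuclideanSpace ℝ (Fin d)), MeasurableSet S →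
      Measurable fun x : Fin d → ℝ =>
        S.indicator (1 : EuclideanSpace ℝ (Fin d) → ℝ≥0∞) (WithLp.toLp 2 x) := fun S hS =>
    (measurable_one.indicator hS).comp (MeasurableEquiv.toLp 2 (Fin d → ℝ)).measurable
  have := prekopaLeindler d ha hb hab (hmeas A hA) (hmeas (-A) hA.neg) (hmeas B hB)
    fun x y => by
      by_cases hx : WithLp.toLp 2 x ∈ A
      · by_cases hy : WithLp.toLp 2 y ∈ -A
        · have := h _ hx _ hy
          rw [smul_neg, sub_neg_eq_add] at this
          simp [hx, hy, this]
        · simp [hy, hb]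
      · simp [hx, ha]
  rw [key A hA, key (-A) hA.neg, key B hB, Measure.measure_neg] at this
  by_cases h0 : volume A = 0
  · simp [h0]
  by_cases hi : volume A = ⊤
  · rw [hi] at this ⊢
    simpa [ENNReal.top_rpow_of_pos, ha, hb] using this
  · rwa [← ENNReal.rpow_add _ _ h0 hi, hab, ENNReal.rpow_one] at this

/-- If `A` has diameter at most `2 R`, its `ε R`-neighbourhood contains `(1 + ε/2) A + (ε/2) (-A)`,
so has at least `(1 + ε) ^ d` times its volume. -/
theorem mul_volume_le_of_diam_le {d : ℕ} {A B : Set (EuclideanSpace ℝ (Fin d))}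
    (hA : MeasurableSet A) (hB : MeasurableSet B) {R ε : ℝ} (hε : 0 < ε)
    (hR : ∀ x ∈ A, ∀ y ∈ A, dist x y ≤ 2 * R)
    (h : ∀ x ∈ A, ∀ z, dist z x ≤ ε * R → z ∈ B) :
    ENNReal.ofReal ((1 + ε) ^ d) * volume A ≤ volume B := by
  have h1 : (0 : ℝ) < 1 + ε := by linarith
  have hBM := volume_le_of_convexCombination_neg (A := A) (B := (1 + ε)⁻¹ • B)
    (a := (1 + ε)⁻¹ * (1 + ε / 2)) (b := (1 + ε)⁻¹ * (ε / 2)) hA (hB.const_smul₀ _)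
    (by positivity) (by positivity) (by field_simp; ring) (fun x hx y hy => by
      rw [mul_smul, mul_smul, ← smul_sub]
      refine Set.smul_mem_smul_set (h x hx _ ?_)
      rw [dist_eq_norm, show (1 + ε / 2) • x - (ε / 2) • y - x = (ε / 2) • (x - y) by module,
        norm_smul, Real.norm_of_nonneg (by positivity), ← dist_eq_norm]
      have := hR x hx y hy
      nlinarith)
  rw [Measure.addHaar_smul, finrank_euclideanSpace_fin, abs_of_pos (by positivity)] at hBM
  calc ENNReal.ofReal ((1 + ε) ^ d) * volume A
      ≤ ENNReal.ofReal ((1 + ε) ^ d) * (ENNReal.ofReal ((1 + ε)⁻¹ ^ d) * volume B) := by gcongr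
    _ = volume B := by
      rw [← mul_assoc, ← ENNReal.ofReal_mul (by positivity), ← mul_pow, mul_inv_cancel₀ h1.ne']
      simp

/-- Functional form of `mul_volume_le_of_diam_le`, applied to all superlevel sets of `F` on `D`. -/
theorem mul_lintegral_le_of_diam_le {d : ℕ} {D : Set (EuclideanSpace ℝ (Fin d))}
    (hD : MeasurableSet D) {R ε : ℝ} (hε : 0 < ε) (hR : ∀ x ∈ D, ∀ y ∈ D, dist x y ≤ 2 * R)
    {F Ψ : EuclideanSpace ℝ (Fin d) → ℝ} (hF : Measurable F) (hΨ : Measurable Ψ)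
    (hF0 : ∀ x, 0 ≤ F x) (hΨ0 : ∀ x, 0 ≤ Ψ x)
    (h : ∀ x ∈ D, ∀ z, dist z x ≤ ε * R → F x ≤ Ψ z) :
    ENNReal.ofReal ((1 + ε) ^ d) * ∫⁻ x in D, ENNReal.ofReal (F x) ≤
      ∫⁻ x, ENNReal.ofReal (Ψ x) := by
  rw [lintegral_eq_lintegral_meas_lt _ (Eventually.of_forall hF0) hF.aemeasurable,
    lintegral_eq_lintegral_meas_lt _ (Eventually.of_forall hΨ0) hΨ.aemeasurable]
  have hm : Measurable fun t : ℝ => (volume.restrict D) {x | t < F x} :=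
    Antitone.measurable fun s t hst => measure_mono fun x (hx : _ < _) => hst.trans_lt hx
  rw [← lintegral_const_mul _ hm]
  refine lintegral_mono fun t => ?_
  have hms : MeasurableSet {x | t < F x} := measurableSet_lt measurable_const hF
  simp only [Measure.restrict_apply hms]
  exact mul_volume_le_of_diam_le (hms.inter hD) (measurableSet_lt measurable_const hΨ) hε
    (fun x hx y hy => hR x hx.2 y hy.2) fun x hx z hz => hx.1.trans_le (h x hx.2 z hz)

/-! ### Localization by smooth cutoff functions -/

/-- A nonnegative smooth function with compact support contained in `U`. -/
structure IsCutoff {d : ℕ} (U : Set (EuclideanSpace ℝ (Fin d)))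
    (χ : EuclideanSpace ℝ (Fin d) → ℝ) : Prop where
  contDiff : ContDiff ℝ ∞ χ
  hasCompactSupport : HasCompactSupport χ
  nonneg : ∀ x, 0 ≤ χ x
  tsupport_subset : tsupport χ ⊆ U

theorem IsCutoff.mono {d : ℕ} {U V : Set (EuclideanSpace ℝ (Fin d))}
    {χ : EuclideanSpace ℝ (Fin d) → ℝ} (h : IsCutoff U χ) (hUV : U ⊆ V) : IsCutoff V χ :=
  ⟨h.contDiff, h.hasCompactSupport, h.nonneg, h.tsupport_subset.trans hUV⟩

theorem IsCutoff.mul_left {d : ℕ} {U : Set (EuclideanSpace ℝ (Fin d))}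
    {χ θ : EuclideanSpace ℝ (Fin d) → ℝ} (h : IsCutoff U χ) (hθ : ContDiff ℝ ∞ θ)
    (h0 : ∀ x, 0 ≤ θ x) : IsCutoff U (θ * χ) :=
  ⟨hθ.mul h.contDiff, h.hasCompactSupport.mul_left, fun x => mul_nonneg (h0 x) (h.nonneg x),
    (tsupport_mul_subset_right).trans h.tsupport_subset⟩

theorem exists_isCutoff_eq_one {d : ℕ} {K U : Set (EuclideanSpace ℝ (Fin d))} (hK : IsCompact K)
    (hU : IsOpen U) (hKU : K ⊆ U) :
    ∃ χ, IsCutoff U χ ∧ (∀ x, χ x ≤ 1) ∧ ∀ᶠ x in 𝓝ˢ K, χ x = 1 := by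
  obtain ⟨L, hL, hKL, hLU⟩ := exists_compact_between hK hU hKU
  obtain ⟨f, hf1, hf0, hf⟩ := exists_contMDiffMap_one_nhds_of_subset_interior
    (modelWithCornersSelf ℝ (EuclideanSpace ℝ (Fin d))) (n := ⊤) hK.isClosed hKL
  have hs : tsupport f ⊆ L := closure_minimal (fun x hx => by
    by_contra h
    exact hx (hf0 x h)) hL.isClosed
  exact ⟨f, ⟨f.contMDiff.contDiff, hL.of_isClosed_subset (isClosed_tsupport _) hs,
    fun x => (hf x).1, hs.trans hLU⟩, fun x => (hf x).2, hf1⟩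

/-- An additive property of cutoff functions that holds for cutoffs supported near each point of a
compact set `K` holds for all cutoffs supported in some neighbourhood of `K`. -/
theorem exists_isOpen_forall_isCutoff {d : ℕ} {K : Set (EuclideanSpace ℝ (Fin d))}
    (hK : IsCompact K) {Q : (EuclideanSpace ℝ (Fin d) → ℝ) → Prop} (h0 : Q 0)
    (hadd : ∀ χ₁ χ₂, IsCutoff Set.univ χ₁ → IsCutoff Set.univ χ₂ → Q χ₁ → Q χ₂ → Q (χ₁ + χ₂))
    (hloc : ∀ x ∈ K, ∃ U, IsOpen U ∧ x ∈ U ∧ ∀ χ, IsCutoff U χ → Q χ) :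
    ∃ U, IsOpen U ∧ K ⊆ U ∧ ∀ χ, IsCutoff U χ → Q χ := by
  refine hK.induction_on (p := fun K => ∃ U, IsOpen U ∧ K ⊆ U ∧ ∀ χ, IsCutoff U χ → Q χ)
    ⟨∅, isOpen_empty, subset_rfl, fun χ hχ => ?_⟩
    (fun s t hst ⟨U, hU, htU, h⟩ => ⟨U, hU, hst.trans htU, h⟩) ?_ fun x hx => ?_
  · have : χ = 0 := tsupport_eq_empty_iff.1 (Set.subset_empty_iff.1 hχ.tsupport_subset)
    rwa [this]
  · rintro s t ⟨U, hU, hsU, hQU⟩ ⟨V, hV, htV, hQV⟩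
    refine ⟨U ∪ V, hU.union hV, Set.union_subset_union hsU htV, fun χ hχ => ?_⟩
    -- split `χ = θ χ + (1 - θ) χ` with `θ = 1` near the part of the support outside `V`
    have hc : IsCompact (tsupport χ \ V) := IsCompact.diff hχ.hasCompactSupport hV
    obtain ⟨θ, hθ, hθ1, hθK⟩ := exists_isCutoff_eq_one hc hU fun x hx =>
      (hχ.tsupport_subset hx.1).resolve_right hx.2
    have hsplit : χ = χ * θ + (1 - θ) * χ := by ring
    have h1 : IsCutoff U (χ * θ) := hθ.mul_left hχ.contDiff hχ.nonneg
    have h2 : IsCutoff (U ∪ V) ((1 - θ) * χ) :=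
      hχ.mul_left (contDiff_const.sub hθ.contDiff) fun x => sub_nonneg.2 (hθ1 x)
    have h2' : IsCutoff V ((1 - θ) * χ) := by
      refine ⟨h2.contDiff, h2.hasCompactSupport, h2.nonneg, fun x hx => ?_⟩
      by_contra hxV
      have hxK : x ∈ tsupport χ \ V := ⟨tsupport_mul_subset_right hx, hxV⟩
      have h3 : ∀ᶠ y in 𝓝 x, θ y = 1 := hθK.filter_mono (nhds_le_nhdsSet hxK)
      refine (notMem_tsupport_iff_eventuallyEq.2 ?_) hx
      filter_upwards [h3] with y hy
      simp [hy]
    rw [hsplit]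
    exact hadd _ _ (h1.mono (Set.subset_univ _)) (h2.mono (Set.subset_univ _)) (hQU _ h1)
      (hQV _ h2')
  · obtain ⟨U, hU, hxU, h⟩ := hloc x hx
    exact ⟨U, mem_nhdsWithin_of_mem_nhds (hU.mem_nhds hxU), U, hU, subset_rfl, h⟩

/-! ### Boundary charts -/

/-- The point with base point `x₀`, horizontal coordinate `p ⊥ n` and height `s` along `n`. -/
def chartPoint {d : ℕ} (x₀ n : EuclideanSpace ℝ (Fin d)) (p : (ℝ ∙ n)ᗮ) (s : ℝ) :
    EuclideanSpace ℝ (Fin d) :=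
  x₀ + p + s • n

/-- The horizontal coordinate of `y`. -/
noncomputable def chartProj {d : ℕ} (x₀ n y : EuclideanSpace ℝ (Fin d)) : (ℝ ∙ n)ᗮ :=
  (ℝ ∙ n)ᗮ.orthogonalProjectionOnto (y - x₀)

/-- The height of `y`. -/
noncomputable def chartHeight {d : ℕ} (x₀ n y : EuclideanSpace ℝ (Fin d)) : ℝ :=
  inner ℝ n (y - x₀)

/-- The open cylinder of radius and half-height `a` around `x₀` with axis `n`. -/
def cylinder {d : ℕ} (x₀ n : EuclideanSpace ℝ (Fin d)) (a : ℝ) :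
    Set (EuclideanSpace ℝ (Fin d)) :=
  {y | ‖chartProj x₀ n y‖ < a ∧ |chartHeight x₀ n y| < a}

section Coordinates

variable {d : ℕ} {x₀ n : EuclideanSpace ℝ (Fin d)}

theorem chartPoint_proj_height (hn : ‖n‖ = 1) (y : EuclideanSpace ℝ (Fin d)) :
    chartPoint x₀ n (chartProj x₀ n y) (chartHeight x₀ n y) = y := by
  have h := Submodule.starProjection_add_starProjection_orthogonal (K := ℝ ∙ n) (y - x₀)
  rw [Submodule.starProjection_unit_singleton ℝ hn, Submodule.starProjection_apply] at h
  rw [chartPoint, chartProj, chartHeight, add_assoc, add_comm (Subtype.val _), h]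
  abel

theorem inner_coe_orthogonal (p : (ℝ ∙ n)ᗮ) : inner ℝ n (p : EuclideanSpace ℝ (Fin d)) = 0 :=
  Submodule.mem_orthogonal_singleton_iff_inner_right.1 p.2

theorem chartHeight_chartPoint (hn : ‖n‖ = 1) (p : (ℝ ∙ n)ᗮ) (s : ℝ) :
    chartHeight x₀ n (chartPoint x₀ n p s) = s := by
  simp [chartHeight, chartPoint, add_assoc, inner_add_right, inner_smul_right,
    inner_coe_orthogonal, hn]

theorem chartProj_chartPoint (p : (ℝ ∙ n)ᗮ) (s : ℝ) :
    chartProj x₀ n (chartPoint x₀ n p s) = p := by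
  simp [chartProj, chartPoint, add_assoc, Submodule.orthogonalProjectionOnto_mem_subspace_eq_self]

theorem chartPoint_sub (p q : (ℝ ∙ n)ᗮ) (s t : ℝ) :
    chartPoint x₀ n p s - chartPoint x₀ n q t = ↑(p - q) + (s - t) • n := by
  simp only [chartPoint, Submodule.coe_sub]
  module

theorem norm_chartPoint_sub_le (hn : ‖n‖ = 1) (p q : (ℝ ∙ n)ᗮ) (s t : ℝ) :
    ‖chartPoint x₀ n p s - chartPoint x₀ n q t‖ ≤ ‖p - q‖ + |s - t| := by
  rw [chartPoint_sub]
  refine (norm_add_le _ _).trans ?_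
  rw [norm_smul, hn, mul_one, Real.norm_eq_abs, Submodule.coe_norm]

theorem norm_chartProj_sub_le (y z : EuclideanSpace ℝ (Fin d)) :
    ‖chartProj x₀ n y - chartProj x₀ n z‖ ≤ ‖y - z‖ := by
  rw [chartProj, chartProj, ← map_sub, sub_sub_sub_cancel_right]
  exact Submodule.norm_orthogonalProjectionOnto_apply_le _ _

theorem abs_chartHeight_sub_le (hn : ‖n‖ = 1) (y z : EuclideanSpace ℝ (Fin d)) :
    |chartHeight x₀ n y - chartHeight x₀ n z| ≤ ‖y - z‖ := by
  rw [chartHeight, chartHeight, ← inner_sub_right, sub_sub_sub_cancel_right]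
  simpa [hn] using abs_real_inner_le_norm n (y - z)

theorem continuous_chartProj : Continuous (chartProj x₀ n) := by
  unfold chartProj; fun_prop

theorem continuous_chartHeight : Continuous (chartHeight x₀ n) := by
  unfold chartHeight; fun_prop

theorem continuous_chartPoint :
    Continuous fun q : (ℝ ∙ n)ᗮ × ℝ => chartPoint x₀ n q.1 q.2 := by
  unfold chartPoint; fun_prop

theorem isOpen_cylinder (a : ℝ) : IsOpen (cylinder x₀ n a) :=
  (isOpen_lt continuous_chartProj.norm continuous_const).inter
    (isOpen_lt continuous_chartHeight.abs continuous_const)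

theorem chartPoint_mem_cylinder (hn : ‖n‖ = 1) {p : (ℝ ∙ n)ᗮ} {s a : ℝ} :
    chartPoint x₀ n p s ∈ cylinder x₀ n a ↔ ‖p‖ < a ∧ |s| < a := by
  simp [cylinder, chartProj_chartPoint, chartHeight_chartPoint hn]

theorem mem_cylinder_self {a : ℝ} (ha : 0 < a) : x₀ ∈ cylinder x₀ n a := by
  simp [cylinder, chartProj, chartHeight, ha]

/-- Fubini's theorem in the coordinates of a chart. -/
theorem lintegral_eq_lintegral_chartPoint (hn : ‖n‖ = 1)
    {F : EuclideanSpace ℝ (Fin d) → ℝ≥0∞} (hF : Measurable F) :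
    ∫⁻ y, F y = ∫⁻ p : (ℝ ∙ n)ᗮ, ∫⁻ s : ℝ, F (chartPoint x₀ n p s) := by
  have h1 := ((ℝ ∙ n).measurePreserving_measurableEquivProd x₀).symm
  rw [InnerProductSpace.euclideanHausdorffMeasure_eq_volume] at h1
  have h2 := (LinearIsometryEquiv.toSpanUnitSingleton (𝕜 := ℝ) n hn).measurePreserving
  rw [← h1.lintegral_comp_emb (MeasurableEquiv.measurableEmbedding _), Measure.volume_eq_prod,
    lintegral_prod_symm' (fun q => F (((ℝ ∙ n).measurableEquivProd x₀).symm q))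
      (hF.comp (MeasurableEquiv.measurable _))]
  refine lintegral_congr fun p => ?_
  rw [← h2.lintegral_comp_emb
    (LinearIsometryEquiv.toSpanUnitSingleton (𝕜 := ℝ) n hn).toHomeomorph.measurableEmbedding]
  refine lintegral_congr fun s => ?_
  congr 1
  simp [chartPoint, add_comm, add_assoc]

end Coordinates

/-- In the cylinder of radius and half-height `a` around `x₀` with axis `n`, the set `D` is the
region below the graph of the `κ`-Lipschitz function `g`, which is defined on the whole
hyperplane orthogonal to `n`. -/
structure IsGraphChart {d : ℕ} (D : Set (EuclideanSpace ℝ (Fin d))) (κ : ℝ≥0)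
    (x₀ n : EuclideanSpace ℝ (Fin d)) (a : ℝ) (g : (ℝ ∙ n)ᗮ → ℝ) : Prop where
  norm_eq : ‖n‖ = 1
  pos : 0 < a
  lip : LipschitzWith κ g
  map_zero : g 0 = 0
  mem_iff : ∀ p s, ‖p‖ < a → |s| < a → (chartPoint x₀ n p s ∈ D ↔ s < g p)

/-- Near a boundary point with outward unit normal `n`, the normalized defining function is a small
Lipschitz perturbation of the linear function `⟪n, ·⟫`. -/
theorem exists_defining_function_close_to_linear {d : ℕ} {D : Set (EuclideanSpace ℝ (Fin d))}
    (hD : IsOpen D) (hs : HasSmoothBoundary D) {x₀ : EuclideanSpace ℝ (Fin d)}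
    (hx : x₀ ∈ frontier D) {δ : ℝ≥0} (hδ : 0 < δ) :
    ∃ n : EuclideanSpace ℝ (Fin d), ‖n‖ = 1 ∧ ∃ r > 0, ∃ ρ : EuclideanSpace ℝ (Fin d) → ℝ,
      ρ x₀ = 0 ∧ (∀ y ∈ Metric.ball x₀ r, y ∈ D ↔ ρ y < 0) ∧
      ∀ y ∈ Metric.ball x₀ r, ∀ z ∈ Metric.ball x₀ r,
        |ρ y - ρ z - inner ℝ n (y - z)| ≤ δ * ‖y - z‖ := by
  obtain ⟨U, hU, ρ, hρ, hρ', hUD⟩ := hs x₀ hx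
  set v := gradient ρ x₀
  have hv : v ≠ 0 := by simpa [v, gradient] using hρ'
  have hv0 : 0 < ‖v‖ := norm_pos_iff.2 hv
  have hfd : ∀ y, fderiv ℝ ρ x₀ y = inner ℝ v y := fun y => by simp [v, gradient]
  have hδv : (0 : ℝ≥0) < δ * ‖v‖₊ := mul_pos hδ (by simpa using hv)
  obtain ⟨s, hs, happ⟩ := ((hρ.contDiffAt (x := x₀)).hasStrictFDerivAt
    (by simp)).approximates_deriv_on_nhds (Or.inr hδv)
  obtain ⟨r, hr, hball⟩ := Metric.mem_nhds_iff.1 (inter_mem hU hs)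
  have hx0 : ρ x₀ = 0 := by
    refine le_antisymm ?_ ?_
    · by_contra! h
      have h1 : ∀ᶠ y in 𝓝 x₀, 0 < ρ y := hρ.continuous.continuousAt.eventually (lt_mem_nhds h)
      have h2 : ∃ᶠ y in 𝓝 x₀, y ∈ D := mem_closure_iff_frequently.1 (frontier_subset_closure hx)
      obtain ⟨y, hy, hy1, hyU⟩ := (h2.and_eventually (h1.and hU)).exists
      exact lt_asymm hy1 ((hUD y hyU).1 hy)
    · by_contra! h
      have : x₀ ∈ D := (hUD x₀ (mem_of_mem_nhds hU)).2 h
      rw [hD.frontier_eq] at hx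
      exact hx.2 this
  refine ⟨‖v‖⁻¹ • v, by rw [norm_smul, norm_inv, norm_norm, inv_mul_cancel₀ hv0.ne'], r, hr,
    fun y => ‖v‖⁻¹ * ρ y, by simp [hx0], fun y hy => ?_, fun y hy z hz => ?_⟩
  · rw [hUD y (hball hy).1, mul_neg_iff]
    simp [hv0, hv0.le]
  · have := happ y (hball hy).2 z (hball hz).2
    rw [hfd, Real.norm_eq_abs] at this
    rw [inner_smul_left, ← mul_sub, RCLike.conj_to_real, ← mul_sub, abs_mul,
      abs_of_pos (inv_pos.2 hv0), inv_mul_le_iff₀ hv0]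
    calc _ ≤ _ := this
      _ = _ := by push_cast; ring

/-- Near a boundary point `D` is the region below a `κ`-Lipschitz graph with `κ` as small as
desired. The graph is found by the intermediate value theorem on vertical lines: the defining
function increases along them with slope at least `1 - κ / 2`. -/
theorem exists_isGraphChart {d : ℕ} {D : Set (EuclideanSpace ℝ (Fin d))}
    (hD : IsOpen D) (hs : HasSmoothBoundary D) {x₀ : EuclideanSpace ℝ (Fin d)}
    (hx : x₀ ∈ frontier D) {κ : ℝ≥0} (hκ : 0 < κ) (hκ' : κ ≤ 1 / 2) :
    ∃ n a g, IsGraphChart D κ x₀ n a g := by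
  obtain ⟨n, hn, r, hr, ρ, hρ0, hρD, hρ⟩ :=
    exists_defining_function_close_to_linear hD hs hx (δ := κ / 2) (by positivity)
  have hκ2 : (κ : ℝ) ≤ 1 / 2 := by exact_mod_cast hκ'
  have hκ0 : (0 : ℝ) < κ := by exact_mod_cast hκ
  set a := r / 3 with ha
  have ha0 : 0 < a := by positivity
  have hball : ∀ (p : (ℝ ∙ n)ᗮ) (s : ℝ), ‖p‖ < a → |s| ≤ a →
      chartPoint x₀ n p s ∈ Metric.ball x₀ r := fun p s hp hs => by
    have h := norm_chartPoint_sub_le (x₀ := x₀) hn p 0 s 0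
    have h0 : chartPoint x₀ n 0 0 = x₀ := by simp [chartPoint]
    rw [h0, sub_zero, sub_zero] at h
    rw [mem_ball_iff_norm]
    linarith
  -- the estimate for the increments of the defining function in chart coordinates
  have hest : ∀ (p q : (ℝ ∙ n)ᗮ) (s t : ℝ), ‖p‖ < a → ‖q‖ < a → |s| ≤ a → |t| ≤ a →
      |ρ (chartPoint x₀ n p s) - ρ (chartPoint x₀ n q t) - (s - t)| ≤
        κ / 2 * (‖p - q‖ + |s - t|) := fun p q s t hp hq hs ht => by
    have h := hρ _ (hball p s hp hs) _ (hball q t hq ht)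
    have h1 : inner ℝ n (chartPoint x₀ n p s - chartPoint x₀ n q t) = s - t := by
      rw [chartPoint_sub, inner_add_right, inner_coe_orthogonal, inner_smul_right,
        real_inner_self_eq_norm_sq, hn]
      simp
    rw [h1] at h
    refine h.trans ?_
    push_cast
    gcongr
    exact norm_chartPoint_sub_le hn p q s t
  have hlt : ∀ (p q : (ℝ ∙ n)ᗮ) (s t : ℝ), ‖p‖ < a → ‖q‖ < a → |s| ≤ a → |t| ≤ a →
      κ * ‖p - q‖ < s - t → ρ (chartPoint x₀ n q t) < ρ (chartPoint x₀ n p s) :=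
    fun p q s t hp hq hs ht h => by
    have h1 := (abs_le.1 (hest p q s t hp hq hs ht)).1
    have h2 : 0 ≤ ‖p - q‖ := norm_nonneg _
    have h3 : 0 < s - t := lt_of_le_of_lt (by positivity) h
    rw [abs_of_pos h3] at h1
    nlinarith
  have h00 : chartPoint x₀ n 0 0 = x₀ := by simp [chartPoint]
  have hroot : ∀ p : (ℝ ∙ n)ᗮ, ‖p‖ < a → ∃ s, |s| ≤ a ∧ ρ (chartPoint x₀ n p s) = 0 := by
    intro p hp
    have haa : |a| = a := abs_of_pos ha0
    have hcont : ContinuousOn (fun s => ρ (chartPoint x₀ n p s)) (Set.Icc (-a) a) := by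
      have hL : ContinuousOn ρ (Metric.ball x₀ r) := by
        refine LipschitzOnWith.continuousOn (K := 1 + κ / 2)
          (LipschitzOnWith.of_dist_le_mul fun y hy z hz => ?_)
        have h := abs_le.1 (hρ y hy z hz)
        have h' := abs_le.1 (abs_real_inner_le_norm n (y - z))
        rw [hn, one_mul] at h'
        rw [Real.dist_eq, dist_eq_norm, abs_le]
        push_cast at h ⊢
        constructor <;> linarith
      refine hL.comp (Continuous.continuousOn (by unfold chartPoint; fun_prop)) fun s hs => ?_
      exact hball p s hp (abs_le.2 hs)
    have h1 := abs_le.1 (hest p 0 a 0 hp (by simpa using ha0) haa.le (by simpa using ha0.le))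
    have h2 := abs_le.1 (hest p 0 (-a) 0 hp (by simpa using ha0) (by rw [abs_neg, haa])
      (by simpa using ha0.le))
    simp only [h00, hρ0, sub_zero, abs_neg, haa] at h1 h2
    have h0 : (0 : ℝ) ∈ Set.Icc (ρ (chartPoint x₀ n p (-a))) (ρ (chartPoint x₀ n p a)) := by
      constructor <;> nlinarith [norm_nonneg p]
    obtain ⟨s, hs, hs0⟩ := intermediate_value_Icc (by linarith) hcont h0
    exact ⟨s, abs_le.2 hs, hs0⟩
  choose! g₀ hg₀ hg₀ρ using hroot
  have hlip : LipschitzOnWith κ g₀ (Metric.ball 0 a) := by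
    refine LipschitzOnWith.of_dist_le_mul fun p hp q hq => ?_
    rw [mem_ball_zero_iff] at hp hq
    rw [Real.dist_eq, dist_eq_norm]
    refine abs_sub_le_iff.2 ⟨?_, ?_⟩ <;> by_contra! h
    · have := hlt p q _ _ hp hq (hg₀ p hp) (hg₀ q hq) h
      rw [hg₀ρ p hp, hg₀ρ q hq] at this
      exact lt_irrefl _ this
    · rw [norm_sub_rev] at h
      have := hlt q p _ _ hq hp (hg₀ q hq) (hg₀ p hp) h
      rw [hg₀ρ p hp, hg₀ρ q hq] at this
      exact lt_irrefl _ this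
  obtain ⟨g, hg, hgg⟩ := hlip.extend_real
  have hp0 : ‖(0 : (ℝ ∙ n)ᗮ)‖ < a := by simpa using ha0
  refine ⟨n, a, g, hn, ha0, hg, ?_, fun p s hp hs => ?_⟩
  · rw [← hgg (Metric.mem_ball_self ha0)]
    by_contra h
    have h1 := hg₀ρ 0 hp0
    have h2 : ρ (chartPoint x₀ n 0 0) = 0 := by rw [h00, hρ0]
    rcases lt_or_gt_of_ne h with h | h
    · have := hlt 0 0 0 (g₀ 0) hp0 hp0 (by simpa using ha0.le) (hg₀ 0 hp0) (by simpa using h)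
      linarith
    · have := hlt 0 0 (g₀ 0) 0 hp0 hp0 (hg₀ 0 hp0) (by simpa using ha0.le) (by simpa using h)
      linarith
  · rw [← hgg (by simpa using hp), hρD _ (hball p s hp hs.le)]
    have h1 := hg₀ρ p hp
    constructor
    · intro h
      by_contra! h'
      rcases h'.eq_or_lt with h' | h'
      · rw [← h', h1] at h
        exact lt_irrefl _ h
      · have := hlt p p s (g₀ p) hp hp hs.le (hg₀ p hp) (by simpa using h')
        linarith
    · intro h
      have := hlt p p (g₀ p) s hp hp (hg₀ p hp) hs.le (by simpa using h)
      linarith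

/-! ### Surface measure in a boundary chart -/

theorem euclideanHausdorffMeasure_image_le {X Y : Type*} [EMetricSpace X] [MeasurableSpace X]
    [BorelSpace X] [EMetricSpace Y] [MeasurableSpace Y] [BorelSpace Y] {K : ℝ≥0} {f : X → Y}
    (hf : LipschitzWith K f) (m : ℕ) (s : Set X) :
    (μHE[m] : Measure Y) (f '' s) ≤ (K : ℝ≥0∞) ^ m * (μHE[m] : Measure X) s := by
  have h := hf.hausdorffMeasure_image_le (d := m) (by positivity) s
  rw [ENNReal.rpow_natCast] at h
  rw [Measure.euclideanHausdorffMeasure_def, Measure.euclideanHausdorffMeasure_def,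
    Measure.smul_apply, Measure.smul_apply, ENNReal.smul_def, ENNReal.smul_def, smul_eq_mul,
    smul_eq_mul, mul_left_comm]
  gcongr

namespace IsGraphChart

variable {d : ℕ} {D : Set (EuclideanSpace ℝ (Fin d))} {κ : ℝ≥0}
  {x₀ n : EuclideanSpace ℝ (Fin d)} {a : ℝ} {g : (ℝ ∙ n)ᗮ → ℝ}

theorem sub_le (h : IsGraphChart D κ x₀ n a g) (p q : (ℝ ∙ n)ᗮ) : g p - g q ≤ κ * ‖p - q‖ := by
  have := h.lip.dist_le_mul p q
  rw [Real.dist_eq, dist_eq_norm] at this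
  exact (le_abs_self _).trans this

theorem abs_le (h : IsGraphChart D κ x₀ n a g) (p : (ℝ ∙ n)ᗮ) : |g p| ≤ κ * ‖p‖ := by
  have := h.lip.dist_le_mul p 0
  rwa [Real.dist_eq, h.map_zero, dist_zero_right, sub_zero] at this

theorem abs_lt_half (h : IsGraphChart D κ x₀ n a g) (hκ : κ ≤ 1 / 2) {p : (ℝ ∙ n)ᗮ}
    (hp : ‖p‖ < a) : |g p| < a / 2 := by
  have h1 := h.abs_le p
  have h2 : (κ : ℝ) ≤ 1 / 2 := by exact_mod_cast hκ
  have h3 := h.pos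
  nlinarith [norm_nonneg p]

theorem abs_lt (h : IsGraphChart D κ x₀ n a g) (hκ : κ ≤ 1 / 2) {p : (ℝ ∙ n)ᗮ}
    (hp : ‖p‖ < a) : |g p| < a := by
  have := h.abs_lt_half hκ hp
  linarith [h.pos]

theorem mem_closure_iff (h : IsGraphChart D κ x₀ n a g) {p : (ℝ ∙ n)ᗮ} {s : ℝ}
    (hp : ‖p‖ < a) (hs : |s| < a) : chartPoint x₀ n p s ∈ closure D ↔ s ≤ g p := by
  constructor
  · intro hc
    by_contra! hlt
    have hU : IsOpen {y | g (chartProj x₀ n y) < chartHeight x₀ n y} :=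
      isOpen_lt (h.lip.continuous.comp continuous_chartProj) continuous_chartHeight
    obtain ⟨y, ⟨hy1, hy2⟩, hyD⟩ := _root_.mem_closure_iff.1 hc _
      (hU.inter (isOpen_cylinder (x₀ := x₀) (n := n) a))
      ⟨by simpa [chartProj_chartPoint, chartHeight_chartPoint h.norm_eq] using hlt,
        (chartPoint_mem_cylinder h.norm_eq).2 ⟨hp, hs⟩⟩
    rw [← chartPoint_proj_height (x₀ := x₀) h.norm_eq y, h.mem_iff _ _ hy2.1 hy2.2] at hyD
    exact lt_asymm hyD hy1
  · intro hle
    have hcont : Continuous fun t => chartPoint x₀ n p t := by unfold chartPoint; fun_prop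
    refine mem_closure_of_tendsto (f := fun t => chartPoint x₀ n p t) (b := 𝓝[<] s)
      (hcont.continuousWithinAt.tendsto) ?_
    have h1 : ∀ᶠ t in 𝓝[<] s, |t| < a :=
      nhdsWithin_le_nhds (continuous_abs.continuousAt.eventually (gt_mem_nhds hs))
    filter_upwards [h1, self_mem_nhdsWithin] with t ht hts
    exact (h.mem_iff p t hp ht).2 (lt_of_lt_of_le hts hle)

theorem mem_frontier_iff (h : IsGraphChart D κ x₀ n a g) (hD : IsOpen D) {p : (ℝ ∙ n)ᗮ} {s : ℝ}
    (hp : ‖p‖ < a) (hs : |s| < a) : chartPoint x₀ n p s ∈ frontier D ↔ s = g p := by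
  rw [hD.frontier_eq, Set.mem_sdiff, h.mem_closure_iff hp hs, h.mem_iff p s hp hs, not_lt,
    le_antisymm_iff]

theorem continuous_graph (h : IsGraphChart D κ x₀ n a g) :
    Continuous fun p => chartPoint x₀ n p (g p) :=
  continuous_chartPoint.comp (continuous_id.prodMk h.lip.continuous)

theorem lipschitzWith_graph (h : IsGraphChart D κ x₀ n a g) :
    LipschitzWith (1 + κ) fun p => chartPoint x₀ n p (g p) := by
  refine LipschitzWith.of_dist_le_mul fun p q => ?_
  have h1 := h.lip.dist_le_mul p q
  rw [Real.dist_eq, dist_eq_norm] at h1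
  have := norm_chartPoint_sub_le (x₀ := x₀) h.norm_eq p q (g p) (g q)
  rw [dist_eq_norm, dist_eq_norm]
  push_cast
  linarith

theorem finrank_orthogonal (h : IsGraphChart D κ x₀ n a g) :
    Module.finrank ℝ (ℝ ∙ n)ᗮ = d - 1 := by
  have hn : n ≠ 0 := by
    rintro rfl
    simpa using h.norm_eq
  have := (ℝ ∙ n).finrank_add_finrank_orthogonal
  rw [finrank_span_singleton hn, finrank_euclideanSpace_fin] at this
  omega

/-- Parametrizing `∂D` by the hyperplane does not increase measure, because the orthogonal
projection onto the hyperplane is `1`-Lipschitz. -/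
theorem map_graph_le (h : IsGraphChart D κ x₀ n a g) (hκ : κ ≤ 1 / 2) (hD : IsOpen D) :
    (volume.restrict (Metric.ball 0 a)).map (fun p => chartPoint x₀ n p (g p)) ≤
      surfaceMeasure D := by
  have hm := h.continuous_graph.measurable
  refine Measure.le_iff.2 fun B hB => ?_
  rw [Measure.map_apply hm hB, Measure.restrict_apply (hm hB), surfaceMeasure,
    Measure.restrict_apply hB, ← InnerProductSpace.euclideanHausdorffMeasure_eq_volume,
    h.finrank_orthogonal]
  have hL : LipschitzWith 1 (chartProj x₀ n) := LipschitzWith.of_dist_le_mul fun y z => by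
    rw [dist_eq_norm, dist_eq_norm, NNReal.coe_one, one_mul]
    exact norm_chartProj_sub_le y z
  refine (measure_mono ?_).trans ((euclideanHausdorffMeasure_image_le hL (d - 1)
    (B ∩ frontier D)).trans (by simp))
  rintro p ⟨hpB, hp⟩
  rw [mem_ball_zero_iff] at hp
  exact ⟨_, ⟨hpB, (h.mem_frontier_iff hD hp (h.abs_lt hκ hp)).2 rfl⟩, chartProj_chartPoint _ _⟩

/-- The graph parametrization is `(1 + κ)`-Lipschitz, which bounds the surface measure. -/
theorem surfaceMeasure_restrict_le (h : IsGraphChart D κ x₀ n a g) (hD : IsOpen D) :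
    (surfaceMeasure D).restrict (cylinder x₀ n a) ≤ ((1 + κ : ℝ≥0) : ℝ≥0∞) ^ (d - 1) •
      (volume.restrict (Metric.ball 0 a)).map (fun p => chartPoint x₀ n p (g p)) := by
  have hm := h.continuous_graph.measurable
  refine Measure.le_iff.2 fun B hB => ?_
  rw [Measure.smul_apply, Measure.map_apply hm hB, Measure.restrict_apply (hm hB), surfaceMeasure,
    Measure.restrict_apply hB, Measure.restrict_apply (hB.inter (isOpen_cylinder a).measurableSet),
    ← InnerProductSpace.euclideanHausdorffMeasure_eq_volume, h.finrank_orthogonal, smul_eq_mul]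
  refine (measure_mono ?_).trans (euclideanHausdorffMeasure_image_le h.lipschitzWith_graph (d - 1) _)
  rintro y ⟨⟨hyB, hy1, hy2⟩, hyD⟩
  have hy := chartPoint_proj_height (x₀ := x₀) h.norm_eq y
  rw [← hy, h.mem_frontier_iff hD hy1 hy2] at hyD
  rw [hyD] at hy
  exact ⟨chartProj x₀ n y, ⟨by simpa [hy] using hyB, by simpa using hy1⟩, hy⟩

end IsGraphChart

/-! ### The volume of thin outer layers -/

/-- The outer layer of width `r` around `D`. -/
def outerLayer {d : ℕ} (D : Set (EuclideanSpace ℝ (Fin d))) (r : ℝ) :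
    Set (EuclideanSpace ℝ (Fin d)) :=
  Metric.cthickening r D \ D

theorem exists_mem_closure_dist_le {d : ℕ} {D : Set (EuclideanSpace ℝ (Fin d))} {r : ℝ}
    (hr : 0 ≤ r) (hb : Bornology.IsBounded D)
    {z : EuclideanSpace ℝ (Fin d)} (hz : z ∈ Metric.cthickening r D) :
    ∃ x ∈ closure D, dist z x ≤ r := by
  rw [← Metric.cthickening_closure, hb.isCompact_closure.cthickening_eq_biUnion_closedBall hr] at hz
  simpa using hz

/-- In a chart, a point of the outer layer of width `r` lies above the graph by at most
`(1 + κ) r`; there `χ` differs from its value on the graph by `O(r)`. -/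
theorem IsGraphChart.lintegral_outerLayer_le {d : ℕ} {D : Set (EuclideanSpace ℝ (Fin d))}
    {κ : ℝ≥0} {x₀ n : EuclideanSpace ℝ (Fin d)} {a : ℝ} {g : (ℝ ∙ n)ᗮ → ℝ}
    (h : IsGraphChart D κ x₀ n a g) (hκ : κ ≤ 1 / 2) (hD : IsOpen D) (hb : Bornology.IsBounded D)
    {χ : EuclideanSpace ℝ (Fin d) → ℝ} (hχ : IsCutoff (cylinder x₀ n a) χ) :
    ∃ C : ℝ≥0, ∃ r₀ > 0, ∀ r, 0 < r → r < r₀ →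
      ∫⁻ x in outerLayer D r, ENNReal.ofReal (χ x) ≤ ENNReal.ofReal r *
        ((1 + κ) * ∫⁻ x, ENNReal.ofReal (χ x) ∂(surfaceMeasure D) + C * ENNReal.ofReal r) := by
  obtain ⟨K, hK⟩ := hχ.contDiff.lipschitzWith_of_hasCompactSupport hχ.hasCompactSupport (by simp)
  obtain ⟨r₀, hr₀, hsub⟩ := hχ.hasCompactSupport.isCompact.exists_cthickening_subset_open
    (isOpen_cylinder a) hχ.tsupport_subset
  have hvol : volume (Metric.ball (0 : (ℝ ∙ n)ᗮ) a) ≠ ⊤ := measure_ball_lt_top.ne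
  refine ⟨(1 + κ) ^ 2 * K * (volume (Metric.ball (0 : (ℝ ∙ n)ᗮ) a)).toNNReal, r₀, hr₀,
    fun r hr hrr => ?_⟩
  set w : ℝ := (1 + κ) * r with hw
  have hw0 : 0 ≤ w := by positivity
  have hLm : MeasurableSet (outerLayer D r) :=
    Metric.isClosed_cthickening.measurableSet.diff hD.measurableSet
  have hχm : Measurable fun x => ENNReal.ofReal (χ x) :=
    hχ.contDiff.continuous.measurable.ennreal_ofReal
  have hpt : ∀ (p : (ℝ ∙ n)ᗮ) (s : ℝ),
      (outerLayer D r).indicator (fun x => ENNReal.ofReal (χ x)) (chartPoint x₀ n p s) ≤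
      (Metric.ball (0 : (ℝ ∙ n)ᗮ) a).indicator (fun p =>
        (Set.Icc (g p) (g p + w)).indicator (fun _ =>
          ENNReal.ofReal (χ (chartPoint x₀ n p (g p))) + ENNReal.ofReal (K * w)) s) p := by
    intro p s
    by_cases hz : chartPoint x₀ n p s ∈ outerLayer D r
    · by_cases hz0 : χ (chartPoint x₀ n p s) = 0
      · rw [Set.indicator_of_mem hz, hz0, ENNReal.ofReal_zero]
        exact zero_le
      · have hzs := subset_tsupport χ hz0
        obtain ⟨hp, hs⟩ := (chartPoint_mem_cylinder h.norm_eq).1 (hχ.tsupport_subset hzs)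
        have h1 : g p ≤ s := not_lt.1 fun hlt => hz.2 ((h.mem_iff p s hp hs).2 hlt)
        obtain ⟨x, hxD, hx⟩ := exists_mem_closure_dist_le hr.le hb hz.1
        have hxc : x ∈ cylinder x₀ n a := hsub <|
          Metric.mem_cthickening_of_dist_le x _ _ _ hzs (by rw [dist_comm]; linarith)
        rw [← chartPoint_proj_height (x₀ := x₀) h.norm_eq x,
          h.mem_closure_iff hxc.1 hxc.2] at hxD
        have h2 := _root_.abs_le.1
          (abs_chartHeight_sub_le (x₀ := x₀) h.norm_eq (chartPoint x₀ n p s) x)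
        have h3 := norm_chartProj_sub_le (x₀ := x₀) (n := n) (chartPoint x₀ n p s) x
        have h4 := h.sub_le (chartProj x₀ n x) p
        rw [norm_sub_rev] at h4
        rw [chartHeight_chartPoint h.norm_eq, ← dist_eq_norm] at h2
        rw [chartProj_chartPoint, ← dist_eq_norm (chartPoint x₀ n p s)] at h3
        have h5 : s ≤ g p + w := by
          have : (κ : ℝ) * ‖p - chartProj x₀ n x‖ ≤ κ * r := by gcongr; linarith
          rw [hw]
          linarith [h2.2]
        rw [Set.indicator_of_mem hz, Set.indicator_of_mem (by simpa using hp),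
          Set.indicator_of_mem (Set.mem_Icc.2 ⟨h1, h5⟩),
          ← ENNReal.ofReal_add (hχ.nonneg _) (by positivity)]
        refine ENNReal.ofReal_le_ofReal ?_
        have h6 := hK.dist_le_mul (chartPoint x₀ n p s) (chartPoint x₀ n p (g p))
        have h7 := norm_chartPoint_sub_le (x₀ := x₀) h.norm_eq p p s (g p)
        rw [Real.dist_eq, dist_eq_norm] at h6
        rw [sub_self, norm_zero, zero_add, abs_of_nonneg (by linarith)] at h7
        have h8 : (K : ℝ) * ‖chartPoint x₀ n p s - chartPoint x₀ n p (g p)‖ ≤ K * w := by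
          gcongr; linarith
        linarith [(_root_.abs_le.1 h6).2]
    · simp [hz]
  calc ∫⁻ x in outerLayer D r, ENNReal.ofReal (χ x)
      = ∫⁻ p : (ℝ ∙ n)ᗮ, ∫⁻ s : ℝ,
          (outerLayer D r).indicator (fun x => ENNReal.ofReal (χ x)) (chartPoint x₀ n p s) := by
        rw [← lintegral_indicator hLm,
          lintegral_eq_lintegral_chartPoint h.norm_eq (hχm.indicator hLm)]
    _ ≤ ∫⁻ p : (ℝ ∙ n)ᗮ, (Metric.ball (0 : (ℝ ∙ n)ᗮ) a).indicator (fun p =>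
          (ENNReal.ofReal (χ (chartPoint x₀ n p (g p))) + ENNReal.ofReal (K * w)) *
            ENNReal.ofReal w) p := by
        refine lintegral_mono fun p => (lintegral_mono (hpt p)).trans ?_
        by_cases hp : p ∈ Metric.ball (0 : (ℝ ∙ n)ᗮ) a
        · simp only [Set.indicator_of_mem hp]
          rw [lintegral_indicator measurableSet_Icc, setLIntegral_const, Real.volume_Icc,
            add_sub_cancel_left]
        · simp [hp]
    _ = (∫⁻ x, ENNReal.ofReal (χ x) ∂((volume.restrict (Metric.ball 0 a)).map
          (fun p => chartPoint x₀ n p (g p))) +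
          ENNReal.ofReal (K * w) * volume (Metric.ball (0 : (ℝ ∙ n)ᗮ) a)) * ENNReal.ofReal w := by
        have hm : Measurable fun p => ENNReal.ofReal (χ (chartPoint x₀ n p (g p))) :=
          hχm.comp h.continuous_graph.measurable
        rw [lintegral_indicator measurableSet_ball, lintegral_mul_const _
          (by fun_prop),
          lintegral_add_right _ measurable_const, setLIntegral_const,
          lintegral_map hχm h.continuous_graph.measurable]
    _ ≤ (∫⁻ x, ENNReal.ofReal (χ x) ∂(surfaceMeasure D) +
          ENNReal.ofReal (K * w) * volume (Metric.ball (0 : (ℝ ∙ n)ᗮ) a)) * ENNReal.ofReal w := by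
        gcongr
        exact h.map_graph_le hκ hD
    _ = _ := by
        rw [hw, ENNReal.ofReal_mul (by positivity), ENNReal.ofReal_mul (by positivity),
          ENNReal.ofReal_add (by positivity) (by positivity)]
        simp only [ENNReal.ofReal_coe_nnreal, ENNReal.ofReal_one]
        push_cast
        rw [ENNReal.coe_toNNReal hvol]
        ring

/-! ### The trace inequality for smooth functions -/

/-- The one-dimensional trace inequality: integrate the derivative of `(s + a) u(s)²`, whose weight
vanishes at `-a` and is at least `a / 2` at `b`. -/
theorem sq_le_integral_of_hasDerivAt {u u' : ℝ → ℝ} (hu : ∀ s, HasDerivAt u (u' s) s)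
    (hu' : Continuous u') {a b : ℝ} (ha : 0 < a) (hb : |b| < a / 2) :
    a / 2 * u b ^ 2 ≤ ∫ s in (-a)..b, (1 + 2 * a) * (u s ^ 2 + u' s ^ 2) := by
  have hb' := abs_lt.1 hb
  have huc : Continuous u := continuous_iff_continuousAt.2 fun s => (hu s).continuousAt
  have hd : ∀ s, HasDerivAt (fun s => (s + a) * u s ^ 2)
      (u s ^ 2 + (s + a) * (2 * u s * u' s)) s := fun s => by
    have h := ((hasDerivAt_id s).add_const a).mul ((hu s).pow 2)
    refine h.congr_deriv ?_
    simp
  have h1 := intervalIntegral.integral_eq_sub_of_hasDerivAt (a := -a) (b := b) (fun s _ => hd s)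
    (Continuous.intervalIntegrable (by fun_prop) _ _)
  have h2 : ∫ s in (-a)..b, (u s ^ 2 + (s + a) * (2 * u s * u' s)) ≤
      ∫ s in (-a)..b, (1 + 2 * a) * (u s ^ 2 + u' s ^ 2) := by
    refine intervalIntegral.integral_mono_on (by linarith)
      (Continuous.intervalIntegrable (by fun_prop) _ _)
      (Continuous.intervalIntegrable (by fun_prop) _ _) fun s hs => ?_
    have h3 : 0 ≤ s + a := by linarith [hs.1]
    have h4 : s + a ≤ 2 * a := by linarith [hs.2]
    have h5 : 2 * u s * u' s ≤ u s ^ 2 + u' s ^ 2 := by nlinarith [sq_nonneg (u s - u' s)]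
    have h6 : 0 ≤ u s ^ 2 + u' s ^ 2 := by positivity
    nlinarith [mul_le_mul_of_nonneg_left h5 h3, mul_le_mul_of_nonneg_right h4 h6, sq_nonneg (u' s)]
  rw [h1] at h2
  refine le_trans ?_ h2
  have : a / 2 ≤ b + a := by linarith
  simp only [neg_add_cancel, zero_mul, sub_zero]
  gcongr

/-- The local trace inequality, by the one-dimensional one on each vertical line of the chart. -/
theorem IsGraphChart.setLIntegral_sq_le {d : ℕ} {D : Set (EuclideanSpace ℝ (Fin d))}
    {κ : ℝ≥0} {x₀ n : EuclideanSpace ℝ (Fin d)} {a : ℝ} {g : (ℝ ∙ n)ᗮ → ℝ}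
    (h : IsGraphChart D κ x₀ n a g) (hκ : κ ≤ 1 / 2) (hD : IsOpen D) :
    ∃ C : ℝ≥0, ∀ φ : EuclideanSpace ℝ (Fin d) → ℝ, ContDiff ℝ 1 φ →
      ∫⁻ x in cylinder x₀ n a, ENNReal.ofReal (φ x ^ 2) ∂(surfaceMeasure D) ≤
        C * ∫⁻ x in D, ENNReal.ofReal (φ x ^ 2 + ‖fderiv ℝ φ x‖ ^ 2) := by
  have ha := h.pos
  refine ⟨(1 + κ) ^ (d - 1) * (2 / a * (1 + 2 * a)).toNNReal, fun φ hφ => ?_⟩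
  have hdφ : Continuous (fderiv ℝ φ) := hφ.continuous_fderiv one_ne_zero
  set E : EuclideanSpace ℝ (Fin d) → ℝ := fun x => φ x ^ 2 + ‖fderiv ℝ φ x‖ ^ 2 with hE
  have hEc : Continuous E := (hφ.continuous.pow 2).add (hdφ.norm.pow 2)
  have hm : Measurable fun x => ENNReal.ofReal (φ x ^ 2) :=
    (hφ.continuous.pow 2).measurable.ennreal_ofReal
  have hEm : Measurable fun x => ENNReal.ofReal (E x) := hEc.measurable.ennreal_ofReal
  have hpt : ∀ p ∈ Metric.ball (0 : (ℝ ∙ n)ᗮ) a,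
      ENNReal.ofReal (φ (chartPoint x₀ n p (g p)) ^ 2) ≤ ENNReal.ofReal (2 / a * (1 + 2 * a)) *
        ∫⁻ s, D.indicator (fun x => ENNReal.ofReal (E x)) (chartPoint x₀ n p s) := by
    intro p hp
    rw [mem_ball_zero_iff] at hp
    have hline : ∀ s, HasDerivAt (fun s => chartPoint x₀ n p s) n s := fun s => by
      simpa [chartPoint] using ((hasDerivAt_id s).smul_const n).const_add (x₀ + (p : _))
    have hlc : Continuous fun s => chartPoint x₀ n p s :=
      continuous_iff_continuousAt.2 fun s => (hline s).continuousAt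
    have hu : ∀ s, HasDerivAt (fun s => φ (chartPoint x₀ n p s))
        (fderiv ℝ φ (chartPoint x₀ n p s) n) s := fun s =>
      ((hφ.differentiable one_ne_zero _).hasFDerivAt).comp_hasDerivAt s (hline s)
    have h1 := sq_le_integral_of_hasDerivAt hu ((hdφ.comp hlc).clm_apply continuous_const) ha
      (h.abs_lt_half hκ hp)
    have hgp := _root_.abs_lt.1 (h.abs_lt_half hκ hp)
    have h2 : φ (chartPoint x₀ n p (g p)) ^ 2 ≤
        ∫ s in (-a)..(g p), (2 / a * (1 + 2 * a)) * E (chartPoint x₀ n p s) := by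
      have h3 : ∫ s in (-a)..(g p), (1 + 2 * a) * (φ (chartPoint x₀ n p s) ^ 2 +
          (fderiv ℝ φ (chartPoint x₀ n p s) n) ^ 2) ≤
          ∫ s in (-a)..(g p), (1 + 2 * a) * E (chartPoint x₀ n p s) := by
        refine intervalIntegral.integral_mono_on (by linarith)
          (Continuous.intervalIntegrable ?_ _ _) (Continuous.intervalIntegrable ?_ _ _)
          fun s _ => ?_
        · exact continuous_const.mul (((hφ.continuous.comp hlc).pow 2).add
            (((hdφ.comp hlc).clm_apply continuous_const).pow 2))
        · exact continuous_const.mul (hEc.comp hlc)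
        · rw [hE]
          dsimp only
          have := (fderiv ℝ φ (chartPoint x₀ n p s)).le_opNorm n
          rw [h.norm_eq, mul_one, Real.norm_eq_abs] at this
          rw [← sq_abs (fderiv ℝ φ (chartPoint x₀ n p s) n)]
          gcongr
      have h4 : ∫ s in (-a)..(g p), (2 / a * (1 + 2 * a)) * E (chartPoint x₀ n p s) =
          2 / a * ∫ s in (-a)..(g p), (1 + 2 * a) * E (chartPoint x₀ n p s) := by
        rw [← intervalIntegral.integral_const_mul]
        simp only [mul_assoc]
      rw [h4, div_mul_eq_mul_div, le_div_iff₀ ha]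
      nlinarith
    rw [intervalIntegral.integral_of_le (by linarith), integral_Ioc_eq_integral_Ioo] at h2
    refine (ENNReal.ofReal_le_ofReal h2).trans ?_
    rw [ofReal_integral_eq_lintegral_ofReal]
    · rw [← lintegral_indicator measurableSet_Ioo,
        ← lintegral_const_mul' _ _ ENNReal.ofReal_ne_top]
      refine lintegral_mono fun s => ?_
      by_cases hs : s ∈ Set.Ioo (-a) (g p)
      · have hsD : chartPoint x₀ n p s ∈ D :=
          (h.mem_iff p s hp (_root_.abs_lt.2 ⟨hs.1, by linarith [hs.2]⟩)).2 hs.2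
        rw [Set.indicator_of_mem hs, Set.indicator_of_mem hsD, ENNReal.ofReal_mul (by positivity)]
      · simp [hs]
    · exact ((continuous_const.mul (hEc.comp hlc)).integrableOn_Icc).mono_set
        Set.Ioo_subset_Icc_self
    · refine Eventually.of_forall fun s => ?_
      simp only [Pi.zero_apply, hE]
      positivity
  calc ∫⁻ x in cylinder x₀ n a, ENNReal.ofReal (φ x ^ 2) ∂(surfaceMeasure D)
      ≤ ∫⁻ x, ENNReal.ofReal (φ x ^ 2) ∂(((1 + κ : ℝ≥0) : ℝ≥0∞) ^ (d - 1) •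
          (volume.restrict (Metric.ball 0 a)).map (fun p => chartPoint x₀ n p (g p))) :=
        lintegral_mono' (h.surfaceMeasure_restrict_le hD) le_rfl
    _ = ((1 + κ : ℝ≥0) : ℝ≥0∞) ^ (d - 1) * ∫⁻ p in Metric.ball (0 : (ℝ ∙ n)ᗮ) a,
          ENNReal.ofReal (φ (chartPoint x₀ n p (g p)) ^ 2) := by
        rw [lintegral_smul_measure, lintegral_map hm h.continuous_graph.measurable, smul_eq_mul]
    _ ≤ ((1 + κ : ℝ≥0) : ℝ≥0∞) ^ (d - 1) * ∫⁻ p : (ℝ ∙ n)ᗮ,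
          ENNReal.ofReal (2 / a * (1 + 2 * a)) *
          ∫⁻ s, D.indicator (fun x => ENNReal.ofReal (E x)) (chartPoint x₀ n p s) := by
        exact mul_le_mul_right ((setLIntegral_mono' measurableSet_ball hpt).trans
          (setLIntegral_le_lintegral _ _)) _
    _ = _ := by
        rw [lintegral_const_mul' _ _ ENNReal.ofReal_ne_top,
          ← lintegral_eq_lintegral_chartPoint h.norm_eq (hEm.indicator hD.measurableSet),
          lintegral_indicator hD.measurableSet, ← mul_assoc]
        push_cast
        rfl

theorem IsSmoothBoundedDomain.isCompact_frontier {d : ℕ} {D : Set (EuclideanSpace ℝ (Fin d))}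
    (hD : IsSmoothBoundedDomain D) : IsCompact (frontier D) :=
  hD.isBounded.isCompact_closure.of_isClosed_subset isClosed_frontier frontier_subset_closure

/-- The trace inequality for smooth functions. -/
theorem IsSmoothBoundedDomain.exists_lintegral_surfaceMeasure_le {d : ℕ}
    {D : Set (EuclideanSpace ℝ (Fin d))} (hD : IsSmoothBoundedDomain D) :
    ∃ C : ℝ≥0, ∀ φ : EuclideanSpace ℝ (Fin d) → ℝ, ContDiff ℝ 1 φ →
      ∫⁻ x, ENNReal.ofReal (φ x ^ 2) ∂(surfaceMeasure D) ≤
        C * ∫⁻ x in D, ENNReal.ofReal (φ x ^ 2 + ‖fderiv ℝ φ x‖ ^ 2) := by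
  have key : ∃ C : ℝ≥0, ∀ φ : EuclideanSpace ℝ (Fin d) → ℝ, ContDiff ℝ 1 φ →
      ∫⁻ x in frontier D, ENNReal.ofReal (φ x ^ 2) ∂(surfaceMeasure D) ≤
        C * ∫⁻ x in D, ENNReal.ofReal (φ x ^ 2 + ‖fderiv ℝ φ x‖ ^ 2) := by
    refine hD.isCompact_frontier.induction_on
      (p := fun s => ∃ C : ℝ≥0, ∀ φ : EuclideanSpace ℝ (Fin d) → ℝ, ContDiff ℝ 1 φ →
      ∫⁻ x in s, ENNReal.ofReal (φ x ^ 2) ∂(surfaceMeasure D) ≤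
        C * ∫⁻ x in D, ENNReal.ofReal (φ x ^ 2 + ‖fderiv ℝ φ x‖ ^ 2))
      ⟨0, fun φ _ => by simp⟩ ?_ ?_ ?_
    · rintro s t hst ⟨C, hC⟩
      exact ⟨C, fun φ hφ => (lintegral_mono_set hst).trans (hC φ hφ)⟩
    · rintro s t ⟨C, hC⟩ ⟨C', hC'⟩
      refine ⟨C + C', fun φ hφ => (lintegral_union_le _ _ _).trans ?_⟩
      rw [ENNReal.coe_add, add_mul]
      exact add_le_add (hC φ hφ) (hC' φ hφ)
    · intro x hx
      obtain ⟨n, a, g, h⟩ := exists_isGraphChart hD.isOpen hD.smooth hx (κ := 1 / 2)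
        (by positivity) le_rfl
      exact ⟨cylinder x n a, mem_nhdsWithin_of_mem_nhds
        ((isOpen_cylinder a).mem_nhds (mem_cylinder_self h.pos)),
        h.setLIntegral_sq_le le_rfl hD.isOpen⟩
  rw [surfaceMeasure] at key ⊢
  rwa [Measure.restrict_restrict isClosed_frontier.measurableSet, Set.inter_self] at key

theorem IsSmoothBoundedDomain.isFiniteMeasure_interiorMeasure {d : ℕ}
    {D : Set (EuclideanSpace ℝ (Fin d))} (hD : IsSmoothBoundedDomain D) :
    IsFiniteMeasure (interiorMeasure D) :=
  ⟨by simpa [interiorMeasure] using hD.isBounded.measure_lt_top⟩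

theorem IsSmoothBoundedDomain.isFiniteMeasure_surfaceMeasure {d : ℕ}
    {D : Set (EuclideanSpace ℝ (Fin d))} (hD : IsSmoothBoundedDomain D) :
    IsFiniteMeasure (surfaceMeasure D) := by
  obtain ⟨C, hC⟩ := hD.exists_lintegral_surfaceMeasure_le
  have h := hC (fun _ => 1) contDiff_const
  simp only [one_pow, fderiv_fun_const, Pi.zero_apply, norm_zero, ne_eq, OfNat.ofNat_ne_zero,
    not_false_eq_true, zero_pow, add_zero, ENNReal.ofReal_one, lintegral_const, one_mul,
    Measure.restrict_apply_univ] at h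
  exact ⟨h.trans_lt (ENNReal.mul_lt_top ENNReal.coe_lt_top hD.isBounded.measure_lt_top)⟩

/-- The segment from a point of the layer to a nearby point of `closure D` meets the boundary. -/
theorem exists_mem_frontier_dist_le {d : ℕ} {D : Set (EuclideanSpace ℝ (Fin d))} {r : ℝ}
    (hr : 0 ≤ r) (hb : Bornology.IsBounded D) (hD : IsOpen D)
    {z : EuclideanSpace ℝ (Fin d)} (hz : z ∈ outerLayer D r) :
    ∃ x ∈ frontier D, dist z x ≤ r := by
  obtain ⟨x, hx, hzx⟩ := exists_mem_closure_dist_le hr hb hz.1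
  by_cases hxD : x ∈ D
  · have hseg : ∃ w ∈ segment ℝ z x, w ∈ frontier D := by
      by_contra! hno
      obtain ⟨w, -, hwD, hwc⟩ := (convex_segment z x).isPreconnected D (closure D)ᶜ hD
        isClosed_closure.isOpen_compl
        (fun w hw => or_iff_not_imp_left.2 fun hwD hwc => hno w hw (hD.frontier_eq ▸ ⟨hwc, hwD⟩))
        ⟨x, right_mem_segment ℝ z x, hxD⟩
        ⟨z, left_mem_segment ℝ z x, fun hzc =>
          hno z (left_mem_segment ℝ z x) (hD.frontier_eq ▸ ⟨hzc, hz.2⟩)⟩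
      exact hwc (subset_closure hwD)
    obtain ⟨w, hw, hwD⟩ := hseg
    refine ⟨w, hwD, le_trans ?_ hzx⟩
    obtain ⟨t, ⟨ht0, ht1⟩, rfl⟩ := (segment_eq_image_lineMap ℝ z x) ▸ hw
    rw [dist_left_lineMap, Real.norm_of_nonneg ht0]
    exact mul_le_of_le_one_left dist_nonneg ht1
  · exact ⟨x, by rw [hD.frontier_eq]; exact ⟨hx, hxD⟩, hzx⟩

/-- Integrals over the outer layer of width `r` are at most `r` times the surface integral, up to
higher order terms and a factor `1 + κ` arbitrarily close to `1`. -/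
theorem IsSmoothBoundedDomain.lintegral_outerLayer_le {d : ℕ}
    {D : Set (EuclideanSpace ℝ (Fin d))} (hD : IsSmoothBoundedDomain D) {κ : ℝ≥0} (hκ : 0 < κ)
    (hκ' : κ ≤ 1 / 2) {f : EuclideanSpace ℝ (Fin d) → ℝ} (hf : IsCutoff Set.univ f) :
    ∃ C : ℝ≥0, ∃ r₀ > 0, ∀ r, 0 < r → r < r₀ →
      ∫⁻ x in outerLayer D r, ENNReal.ofReal (f x) ≤ ENNReal.ofReal r *
        ((1 + κ) * ∫⁻ x, ENNReal.ofReal (f x) ∂(surfaceMeasure D) + C * ENNReal.ofReal r) := by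
  have key : ∃ U, IsOpen U ∧ frontier D ⊆ U ∧ ∀ χ, IsCutoff U χ →
      ∃ C : ℝ≥0, ∃ r₀ > 0, ∀ r, 0 < r → r < r₀ →
      ∫⁻ x in outerLayer D r, ENNReal.ofReal (χ x) ≤ ENNReal.ofReal r *
        ((1 + κ) * ∫⁻ x, ENNReal.ofReal (χ x) ∂(surfaceMeasure D) + C * ENNReal.ofReal r) := by
    refine exists_isOpen_forall_isCutoff hD.isCompact_frontier
      ⟨0, 1, one_pos, fun r _ _ => by simp⟩ ?_ fun x hx => ?_
    · rintro χ₁ χ₂ h₁ h₂ ⟨C₁, r₁, hr₁, H₁⟩ ⟨C₂, r₂, hr₂, H₂⟩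
      refine ⟨C₁ + C₂, min r₁ r₂, lt_min hr₁ hr₂, fun r hr hrr => ?_⟩
      have hm : Measurable fun x => ENNReal.ofReal (χ₁ x) :=
        h₁.contDiff.continuous.measurable.ennreal_ofReal
      simp only [Pi.add_apply, fun x => ENNReal.ofReal_add (h₁.nonneg x) (h₂.nonneg x)]
      rw [lintegral_add_left hm, lintegral_add_left hm, ENNReal.coe_add]
      refine (add_le_add (H₁ r hr (hrr.trans_le (min_le_left _ _)))
        (H₂ r hr (hrr.trans_le (min_le_right _ _)))).trans (le_of_eq ?_)
      ring
    · obtain ⟨n, a, g, h⟩ := exists_isGraphChart hD.isOpen hD.smooth hx hκ hκ'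
      exact ⟨_, isOpen_cylinder a, mem_cylinder_self h.pos,
        fun χ hχ => h.lintegral_outerLayer_le hκ' hD.isOpen hD.isBounded hχ⟩
  obtain ⟨U, hU, hDU, hQ⟩ := key
  obtain ⟨χ, hχ, hχ1, hχD⟩ := exists_isCutoff_eq_one hD.isCompact_frontier hU hDU
  obtain ⟨V, hV, hDV, hV1⟩ := eventually_nhdsSet_iff_exists.1 hχD
  obtain ⟨δ, hδ, hδV⟩ := hD.isCompact_frontier.exists_cthickening_subset_open hV hDV
  obtain ⟨C, r₀, hr₀, h⟩ := hQ (f * χ) (hχ.mul_left hf.contDiff hf.nonneg)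
  refine ⟨C, min r₀ δ, lt_min hr₀ hδ, fun r hr hrr => ?_⟩
  calc ∫⁻ x in outerLayer D r, ENNReal.ofReal (f x)
      = ∫⁻ x in outerLayer D r, ENNReal.ofReal ((f * χ) x) := by
        refine setLIntegral_congr_fun
          (Metric.isClosed_cthickening.measurableSet.diff hD.isOpen.measurableSet) fun z hz => ?_
        obtain ⟨x, hx, hzx⟩ := exists_mem_frontier_dist_le hr.le hD.isBounded hD.isOpen hz
        have : χ z = 1 := hV1 z (hδV (Metric.mem_cthickening_of_dist_le z x _ _ hx
          (hzx.trans (hrr.trans_le (min_le_right _ _)).le)))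
        simp [this]
    _ ≤ _ := h r hr (hrr.trans_le (min_le_left _ _))
    _ ≤ _ := by
        gcongr with x
        exact mul_le_of_le_one_right (hf.nonneg x) (hχ1 x)

/-! ### The weighted isoperimetric inequality for smooth functions -/

theorem abs_sub_sub_fderiv_le {E : Type*} [NormedAddCommGroup E] [NormedSpace ℝ E] {f : E → ℝ}
    (hf : Differentiable ℝ f) {M : ℝ≥0} (hM : LipschitzWith M (fderiv ℝ f)) {x z : E} {r : ℝ}
    (h : dist x z ≤ r) : |f x - f z - fderiv ℝ f z (x - z)| ≤ M * r ^ 2 := by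
  have h0 : 0 ≤ r := dist_nonneg.trans h
  have h1 := (convex_closedBall z r).norm_image_sub_le_of_norm_fderiv_le' (f := f) (C := M * r)
    (φ := fderiv ℝ f z) (fun y _ => hf y) (fun y hy => ?_) (Metric.mem_closedBall_self h0)
    (Metric.mem_closedBall.2 h)
  · rw [Real.norm_eq_abs, ← dist_eq_norm] at h1
    refine h1.trans ?_
    rw [pow_two, ← mul_assoc]
    gcongr
  · rw [← dist_eq_norm]
    refine (hM.dist_le_mul y z).trans ?_
    gcongr
    exact Metric.mem_closedBall.1 hy

theorem IsSmoothBoundedDomain.diam_pos {d : ℕ} (hd : 1 ≤ d) {D : Set (EuclideanSpace ℝ (Fin d))}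
    (hD : IsSmoothBoundedDomain D) : 0 < Metric.diam D := by
  have : Nonempty (Fin d) := ⟨⟨0, hd⟩⟩
  obtain ⟨x, hx⟩ := hD.isConnected.nonempty
  obtain ⟨y, hy, hyx⟩ := (infinite_of_mem_nhds x (hD.isOpen.mem_nhds hx)).nontrivial.exists_ne x
  exact (dist_pos.2 hyx).trans_le (Metric.dist_le_diam_of_mem hD.isBounded hy hx)

/-- One step of the inflation argument: the comparison function is the first-order upper bound for
`f` inside `D`, and a crude bound on the outer layer. -/
theorem IsSmoothBoundedDomain.mul_lintegral_le_add_outerLayer {d : ℕ}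
    {D : Set (EuclideanSpace ℝ (Fin d))} (hD : IsSmoothBoundedDomain D)
    {f : EuclideanSpace ℝ (Fin d) → ℝ} (hf : IsCutoff Set.univ f) {K M : ℝ≥0}
    (hK : LipschitzWith K f) (hM : LipschitzWith M (fderiv ℝ f)) {ε r : ℝ} (hε : 0 < ε)
    (hr : 0 < r) (hεr : r = ε * (Metric.diam D / 2)) :
    ENNReal.ofReal ((1 + ε) ^ d) * ∫⁻ x in D, ENNReal.ofReal (f x) ≤
      ((∫⁻ x in D, ENNReal.ofReal (f x)) + ENNReal.ofReal r * (∫⁻ x in D, ‖fderiv ℝ f x‖ₑ) +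
        M * ENNReal.ofReal r ^ 2 * volume D) +
      ((∫⁻ x in outerLayer D r, ENNReal.ofReal (f x)) +
        K * ENNReal.ofReal r * volume (outerLayer D r)) := by
  have hdf : Differentiable ℝ f := hf.contDiff.differentiable (by simp)
  have hfc := hf.contDiff.continuous
  have hfdc : Continuous (fderiv ℝ f) := hf.contDiff.continuous_fderiv (by simp)
  have hLm : MeasurableSet (outerLayer D r) :=
    Metric.isClosed_cthickening.measurableSet.diff hD.isOpen.measurableSet
  set A : EuclideanSpace ℝ (Fin d) → ℝ := fun z => f z + r * ‖fderiv ℝ f z‖ + M * r ^ 2 with hA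
  set B : EuclideanSpace ℝ (Fin d) → ℝ := fun z => f z + K * r with hB
  have hA0 : ∀ z, 0 ≤ A z := fun z => by have := hf.nonneg z; positivity
  have hB0 : ∀ z, 0 ≤ B z := fun z => by have := hf.nonneg z; positivity
  have hAm : Measurable A := by fun_prop
  have hBm : Measurable B := by fun_prop
  have h := mul_lintegral_le_of_diam_le (R := Metric.diam D / 2) (F := f)
    (Ψ := fun z => D.indicator A z + (outerLayer D r).indicator B z) hD.isOpen.measurableSet hε
    (fun x hx y hy => by
      rw [mul_div_cancel₀ _ two_ne_zero]
      exact Metric.dist_le_diam_of_mem hD.isBounded hx hy)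
    hfc.measurable ((hAm.indicator hD.isOpen.measurableSet).add (hBm.indicator hLm)) hf.nonneg
    (fun z => add_nonneg (Set.indicator_nonneg (fun z _ => hA0 z) z)
      (Set.indicator_nonneg (fun z _ => hB0 z) z))
    (fun x hx z hz => by
      rw [← hεr] at hz
      by_cases hzD : z ∈ D
      · have hzL : z ∉ outerLayer D r := fun h => h.2 hzD
        rw [Set.indicator_of_mem hzD, Set.indicator_of_notMem hzL, add_zero]
        rw [dist_comm] at hz
        have h1 := (abs_le.1 (abs_sub_sub_fderiv_le hdf hM hz)).2
        have h2 := (le_abs_self _).trans ((fderiv ℝ f z).le_opNorm (x - z))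
        rw [← dist_eq_norm] at h2
        have h3 : ‖fderiv ℝ f z‖ * dist x z ≤ r * ‖fderiv ℝ f z‖ := by rw [mul_comm r]; gcongr
        simp only [hA]
        linarith
      · have hzL : z ∈ outerLayer D r := ⟨Metric.mem_cthickening_of_dist_le z x _ _ hx hz, hzD⟩
        rw [Set.indicator_of_notMem hzD, Set.indicator_of_mem hzL, zero_add]
        have h1 := hK.dist_le_mul x z
        rw [dist_comm x z, Real.dist_eq] at h1
        have h2 : (K : ℝ) * dist z x ≤ K * r := by gcongr
        simp only [hB]
        linarith [(abs_le.1 h1).2])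
  refine h.trans ?_
  have hsplit : ∀ z, ENNReal.ofReal (D.indicator A z + (outerLayer D r).indicator B z) =
      D.indicator (fun z => ENNReal.ofReal (A z)) z +
        (outerLayer D r).indicator (fun z => ENNReal.ofReal (B z)) z := fun z => by
    rw [ENNReal.ofReal_add (Set.indicator_nonneg (fun z _ => hA0 z) z)
      (Set.indicator_nonneg (fun z _ => hB0 z) z)]
    congr 1
    · by_cases h : z ∈ D <;> simp [h]
    · by_cases h : z ∈ outerLayer D r <;> simp [h]
  simp only [hsplit]
  rw [lintegral_add_left (hAm.ennreal_ofReal.indicator hD.isOpen.measurableSet),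
    lintegral_indicator hD.isOpen.measurableSet, lintegral_indicator hLm]
  refine add_le_add (le_of_eq ?_) (le_of_eq ?_)
  · have : ∀ z, ENNReal.ofReal (A z) = ENNReal.ofReal (f z) +
        ENNReal.ofReal r * ‖fderiv ℝ f z‖ₑ + M * ENNReal.ofReal r ^ 2 := fun z => by
      have := hf.nonneg z
      rw [hA, ENNReal.ofReal_add (by positivity) (by positivity),
        ENNReal.ofReal_add (by positivity) (by positivity), ENNReal.ofReal_mul hr.le,
        ofReal_norm, ENNReal.ofReal_mul (by positivity), ENNReal.ofReal_coe_nnreal,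
        ENNReal.ofReal_pow hr.le]
    simp only [this]
    rw [lintegral_add_right _ measurable_const, lintegral_add_left hfc.measurable.ennreal_ofReal,
      lintegral_const_mul' _ _ ENNReal.ofReal_ne_top, setLIntegral_const]
  · have : ∀ z, ENNReal.ofReal (B z) = ENNReal.ofReal (f z) + K * ENNReal.ofReal r := fun z => by
      rw [hB, ENNReal.ofReal_add (hf.nonneg z) (by positivity), ENNReal.ofReal_mul (by positivity),
        ENNReal.ofReal_coe_nnreal]
    simp only [this]
    rw [lintegral_add_right _ measurable_const, setLIntegral_const]

theorem IsCutoff.integrable {d : ℕ} {f : EuclideanSpace ℝ (Fin d) → ℝ}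
    (hf : IsCutoff Set.univ f) (μ : Measure (EuclideanSpace ℝ (Fin d))) [IsFiniteMeasure μ] :
    Integrable f μ :=
  hf.contDiff.continuous.integrable_of_hasCompactSupport hf.hasCompactSupport

/-- The weighted isoperimetric inequality `d ∫_D f ≤ R (∫_D |∇f| + ∫_∂D f dS)` with
`R = diam D / 2`, obtained from Brunn–Minkowski by differentiating in the inflation parameter. -/
theorem IsSmoothBoundedDomain.mul_integral_le {d : ℕ} (hd : 1 ≤ d)
    {D : Set (EuclideanSpace ℝ (Fin d))} (hD : IsSmoothBoundedDomain D)
    {f : EuclideanSpace ℝ (Fin d) → ℝ} (hf : IsCutoff Set.univ f) :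
    d * ∫ x in D, f x ≤ Metric.diam D / 2 *
      ((∫ x in D, ‖fderiv ℝ f x‖) + ∫ x, f x ∂(surfaceMeasure D)) := by
  have hR := hD.diam_pos hd
  set R := Metric.diam D / 2 with hRdef
  have hR0 : 0 < R := by positivity
  have := hD.isFiniteMeasure_surfaceMeasure
  have := hD.isFiniteMeasure_interiorMeasure
  have : IsFiniteMeasure (volume.restrict D) := this
  have hfdc : Continuous (fderiv ℝ f) := hf.contDiff.continuous_fderiv (by simp)
  obtain ⟨K, hK⟩ := hf.contDiff.lipschitzWith_of_hasCompactSupport hf.hasCompactSupport (by simp)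
  obtain ⟨M, hM⟩ := (contDiff_infty_iff_fderiv.1 hf.contDiff).2.lipschitzWith_of_hasCompactSupport
    (hf.hasCompactSupport.fderiv ℝ) (by simp)
  -- a cutoff that is `1` on all layers of width at most `1`
  obtain ⟨θ, hθ, -, hθ1⟩ := exists_isCutoff_eq_one
    (K := Metric.cthickening 1 D) (U := Set.univ)
    (Metric.isCompact_of_isClosed_isBounded Metric.isClosed_cthickening hD.isBounded.cthickening)
    isOpen_univ (Set.subset_univ _)
  have hAe : ∫⁻ x in D, ENNReal.ofReal (f x) = ENNReal.ofReal (∫ x in D, f x) :=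
    (ofReal_integral_eq_lintegral_ofReal (hf.integrable _) (Eventually.of_forall hf.nonneg)).symm
  have hSe : ∫⁻ x, ENNReal.ofReal (f x) ∂(surfaceMeasure D) =
      ENNReal.ofReal (∫ x, f x ∂(surfaceMeasure D)) :=
    (ofReal_integral_eq_lintegral_ofReal (hf.integrable _) (Eventually.of_forall hf.nonneg)).symm
  have hθe : ∫⁻ x, ENNReal.ofReal (θ x) ∂(surfaceMeasure D) =
      ENNReal.ofReal (∫ x, θ x ∂(surfaceMeasure D)) :=
    (ofReal_integral_eq_lintegral_ofReal (hθ.mono (Set.subset_univ _) |>.integrable _)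
      (Eventually.of_forall hθ.nonneg)).symm
  have hBe : ∫⁻ x in D, ‖fderiv ℝ f x‖ₑ = ENNReal.ofReal (∫ x in D, ‖fderiv ℝ f x‖) := by
    rw [ofReal_integral_norm_eq_lintegral_enorm]
    exact hfdc.integrable_of_hasCompactSupport (hf.hasCompactSupport.fderiv ℝ)
  have hVe : volume D = ENNReal.ofReal (volume D).toReal :=
    (ENNReal.ofReal_toReal hD.isBounded.measure_lt_top.ne).symm
  have hA0 : 0 ≤ ∫ x in D, f x := integral_nonneg hf.nonneg
  have hS0 : 0 ≤ ∫ x, f x ∂(surfaceMeasure D) := integral_nonneg hf.nonneg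
  have hθ0 : 0 ≤ ∫ x, θ x ∂(surfaceMeasure D) := integral_nonneg hθ.nonneg
  have hB0 : 0 ≤ ∫ x in D, ‖fderiv ℝ f x‖ := integral_nonneg fun _ => norm_nonneg _
  have hV0 : 0 ≤ (volume D).toReal := ENNReal.toReal_nonneg
  set A := ∫ x in D, f x
  set S := ∫ x, f x ∂(surfaceMeasure D)
  set T := ∫ x, θ x ∂(surfaceMeasure D)
  set B := ∫ x in D, ‖fderiv ℝ f x‖
  set V := (volume D).toReal
  have limit_width : ∀ κ : ℝ≥0, 0 < κ → κ ≤ 1 / 2 → d * A ≤ R * (B + (1 + κ) * S) := by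
    intro κ hκ hκ'
    obtain ⟨C, r₁, hr₁, H⟩ := hD.lintegral_outerLayer_le hκ hκ' hf
    obtain ⟨C', r₂, hr₂, H'⟩ := hD.lintegral_outerLayer_le hκ hκ' hθ
    have bound_width : ∀ᶠ r in 𝓝[>] (0 : ℝ),
        d * A ≤ R * (B + M * r * V + ((1 + κ) * S + C * r) + K * r * ((1 + κ) * T + C' * r)) := by
      filter_upwards [Ioo_mem_nhdsGT (lt_min (lt_min hr₁ hr₂) one_pos)] with r hr
      obtain ⟨hr0, hr'⟩ := hr
      have hrr₁ : r < r₁ := hr'.trans_le ((min_le_left _ _).trans (min_le_left _ _))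
      have hrr₂ : r < r₂ := hr'.trans_le ((min_le_left _ _).trans (min_le_right _ _))
      have hr1 : r < 1 := hr'.trans_le (min_le_right _ _)
      set ε := r / R with hε
      have hε0 : 0 < ε := by positivity
      have h1 := hD.mul_lintegral_le_add_outerLayer hf hK hM hε0 hr0
        (by rw [hε, ← hRdef, div_mul_cancel₀ _ hR0.ne'])
      -- the volume of the layer is its `θ`-integral, since `θ = 1` there
      have hlayer : volume (outerLayer D r) ≤
          ENNReal.ofReal r * ((1 + κ) * ENNReal.ofReal T + C' * ENNReal.ofReal r) := by
        rw [← hθe]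
        refine le_trans ?_ (H' r hr0 hrr₂)
        rw [← setLIntegral_one]
        refine setLIntegral_mono' (Metric.isClosed_cthickening.measurableSet.diff
          hD.isOpen.measurableSet) fun z hz => ?_
        have : θ z = 1 := hθ1.self_of_nhdsSet z (Metric.cthickening_mono hr1.le _ hz.1)
        simp [this]
      have h2 := H r hr0 hrr₁
      rw [hSe] at h2
      rw [hAe, hBe, hVe] at h1
      have h3 := h1.trans (add_le_add_right (add_le_add h2 (mul_le_mul_right hlayer _)) _)
      simp only [ENNReal.ofReal] at h3
      norm_cast at h3
      have h5 := NNReal.coe_le_coe.2 h3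
      simp only [NNReal.coe_add, NNReal.coe_mul, NNReal.coe_pow, NNReal.coe_one,
        Real.coe_toNNReal _ hA0, Real.coe_toNNReal _ hB0, Real.coe_toNNReal _ hS0,
        Real.coe_toNNReal _ hθ0, Real.coe_toNNReal _ hV0, Real.coe_toNNReal _ hr0.le,
        Real.coe_toNNReal _ (by positivity : 0 ≤ (1 + ε) ^ d)] at h5
      -- Bernoulli's inequality replaces the derivative of `(1 + ε) ^ d` at `ε = 0`
      have h6 : 1 + (d : ℝ) * ε ≤ (1 + ε) ^ d := one_add_mul_le_pow (by linarith) d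
      have h7 := (mul_le_mul_of_nonneg_right h6 hA0).trans h5
      have h8 : r * (d * A) ≤ r * (R * (B + M * r * V + ((1 + κ) * S + C * r) +
          K * r * ((1 + κ) * T + C' * r))) := by
        have h9 : d * ε * A ≤ r * (B + M * r * V + ((1 + κ) * S + C * r) +
          K * r * ((1 + κ) * T + C' * r)) := by nlinarith
        have h10 : r * (d * A) = R * (d * ε * A) := by
          rw [hε]; field_simp
        rw [h10, mul_left_comm r R]
        gcongr
      exact le_of_mul_le_mul_left h8 hr0
    refine ge_of_tendsto (f := fun r : ℝ => R * (B + M * r * V + ((1 + κ) * S + C * r) +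
      K * r * ((1 + κ) * T + C' * r))) (x := 𝓝[>] (0 : ℝ)) ?_ bound_width
    refine tendsto_nhdsWithin_of_tendsto_nhds (Continuous.tendsto' (by fun_prop) _ _ (by ring))
  have bound_lip : ∀ᶠ κ : ℝ in 𝓝[>] 0, d * A ≤ R * (B + (1 + κ) * S) := by
    filter_upwards [Ioo_mem_nhdsGT (by norm_num : (0 : ℝ) < 1 / 2)] with κ hκ
    exact limit_width ⟨κ, hκ.1.le⟩ hκ.1 (by exact_mod_cast hκ.2.le)
  refine ge_of_tendsto (f := fun κ : ℝ => R * (B + (1 + κ) * S)) (x := 𝓝[>] (0 : ℝ)) ?_ bound_lip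
  exact tendsto_nhdsWithin_of_tendsto_nhds (Continuous.tendsto' (by fun_prop) _ _ (by ring))

/-! ### The explicit inequality for smooth functions -/

section Continuous

variable {d : ℕ} {D : Set (EuclideanSpace ℝ (Fin d))} {F : Type*} [NormedAddCommGroup F]

theorem memLp_of_continuous_of_ae_mem_closure (hb : Bornology.IsBounded D)
    {μ : Measure (EuclideanSpace ℝ (Fin d))} [IsFiniteMeasure μ] (hμ : ∀ᵐ x ∂μ, x ∈ closure D)
    {f : EuclideanSpace ℝ (Fin d) → F} (hf : Continuous f) (p : ℝ≥0∞) : MemLp f p μ := by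
  obtain ⟨C, hC⟩ := hb.isCompact_closure.exists_bound_of_continuousOn hf.continuousOn
  exact MemLp.of_bound hf.aestronglyMeasurable C (hμ.mono hC)

theorem IsSmoothBoundedDomain.memLp_interiorMeasure (hD : IsSmoothBoundedDomain D)
    {f : EuclideanSpace ℝ (Fin d) → F} (hf : Continuous f) (p : ℝ≥0∞) :
    MemLp f p (interiorMeasure D) := by
  have := hD.isFiniteMeasure_interiorMeasure
  exact memLp_of_continuous_of_ae_mem_closure (μ := interiorMeasure D) hD.isBounded
    ((ae_restrict_mem hD.isOpen.measurableSet).mono fun x hx => subset_closure hx) hf p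

theorem IsSmoothBoundedDomain.memLp_surfaceMeasure (hD : IsSmoothBoundedDomain D)
    {f : EuclideanSpace ℝ (Fin d) → F} (hf : Continuous f) (p : ℝ≥0∞) :
    MemLp f p (surfaceMeasure D) := by
  have := hD.isFiniteMeasure_surfaceMeasure
  exact memLp_of_continuous_of_ae_mem_closure (μ := surfaceMeasure D) hD.isBounded
    ((ae_restrict_mem isClosed_frontier.measurableSet).mono fun x hx => frontier_subset_closure hx)
    hf p

end Continuous

theorem norm_gradient_eq {d : ℕ} (φ : EuclideanSpace ℝ (Fin d) → ℝ) (x : EuclideanSpace ℝ (Fin d)) :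
    ‖gradient φ x‖ = ‖fderiv ℝ φ x‖ := by
  simp [gradient]

theorem continuous_gradient {d : ℕ} {φ : EuclideanSpace ℝ (Fin d) → ℝ} (hφ : ContDiff ℝ ∞ φ) :
    Continuous (gradient φ) :=
  (InnerProductSpace.toDual ℝ _).symm.continuous.comp (hφ.continuous_fderiv (by simp))

/-- The Poincaré–trace inequality with a free parameter `t`, for smooth functions: the weighted
isoperimetric inequality for `f = φ²`, together with `2 t |φ| |∇φ| ≤ t² φ² + |∇φ|²`. -/
theorem IsSmoothBoundedDomain.smooth_poincareTrace {d : ℕ} (hd : 1 ≤ d)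
    {D : Set (EuclideanSpace ℝ (Fin d))} (hD : IsSmoothBoundedDomain D)
    {φ : EuclideanSpace ℝ (Fin d) → ℝ} (hφ : ContDiff ℝ ∞ φ) {t : ℝ} (ht : 0 ≤ t) :
    t * (d / (Metric.diam D / 2) - t) * ∫ x, φ x ^ 2 ∂(interiorMeasure D) ≤
      ∫ x, ‖gradient φ x‖ ^ 2 ∂(interiorMeasure D) + t * ∫ x, φ x ^ 2 ∂(surfaceMeasure D) := by
  have hR : 0 < Metric.diam D / 2 := half_pos (hD.diam_pos hd)
  obtain ⟨χ, hχ, -, hχ1⟩ := exists_isCutoff_eq_one hD.isBounded.isCompact_closure isOpen_univ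
    (Set.subset_univ _)
  set f : EuclideanSpace ℝ (Fin d) → ℝ := (fun x => φ x ^ 2) * χ with hf
  have hfc : IsCutoff Set.univ f := hχ.mul_left (hφ.pow 2) fun x => sq_nonneg _
  have hev : ∀ x ∈ closure D, f =ᶠ[𝓝 x] fun x => φ x ^ 2 := fun x hx => by
    filter_upwards [hχ1.filter_mono (nhds_le_nhdsSet hx)] with y hy
    simp [hf, hy]
  have h := hD.mul_integral_le hd hfc
  have e1 : ∫ x in D, f x = ∫ x, φ x ^ 2 ∂(interiorMeasure D) :=
    setIntegral_congr_fun hD.isOpen.measurableSet fun x hx =>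
      (hev x (subset_closure hx)).self_of_nhds
  have e2 : ∫ x, f x ∂(surfaceMeasure D) = ∫ x, φ x ^ 2 ∂(surfaceMeasure D) :=
    setIntegral_congr_fun isClosed_frontier.measurableSet fun x hx =>
      (hev x (frontier_subset_closure hx)).self_of_nhds
  have e3 : ∫ x in D, ‖fderiv ℝ f x‖ = ∫ x, 2 * |φ x| * ‖gradient φ x‖ ∂(interiorMeasure D) :=
    setIntegral_congr_fun hD.isOpen.measurableSet fun x hx => by
      rw [(hev x (subset_closure hx)).fderiv_eq, norm_gradient_eq,
        ((hφ.differentiable (by simp) x).hasFDerivAt.pow 2).fderiv, norm_smul]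
      simp
  rw [e1, e2, e3] at h
  have hgc := continuous_gradient hφ
  have i1 : Integrable (fun x => φ x ^ 2) (interiorMeasure D) :=
    memLp_one_iff_integrable.1 (hD.memLp_interiorMeasure (hφ.continuous.pow 2) 1)
  have i2 : Integrable (fun x => ‖gradient φ x‖ ^ 2) (interiorMeasure D) :=
    memLp_one_iff_integrable.1 (hD.memLp_interiorMeasure (hgc.norm.pow 2) 1)
  have i3 : Integrable (fun x => 2 * |φ x| * ‖gradient φ x‖) (interiorMeasure D) :=
    memLp_one_iff_integrable.1 (hD.memLp_interiorMeasure
      ((continuous_const.mul hφ.continuous.abs).mul hgc.norm) 1)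
  have h2 : t * ∫ x, 2 * |φ x| * ‖gradient φ x‖ ∂(interiorMeasure D) ≤
      t ^ 2 * ∫ x, φ x ^ 2 ∂(interiorMeasure D) +
        ∫ x, ‖gradient φ x‖ ^ 2 ∂(interiorMeasure D) := by
    rw [← integral_const_mul, ← integral_const_mul, ← integral_add (i1.const_mul _) i2]
    refine integral_mono (i3.const_mul _) ((i1.const_mul _).add i2) fun x => ?_
    have := sq_nonneg (t * |φ x| - ‖gradient φ x‖)
    rw [← sq_abs (φ x)]
    nlinarith
  have h3 : d / (Metric.diam D / 2) * ∫ x, φ x ^ 2 ∂(interiorMeasure D) ≤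
      ∫ x, 2 * |φ x| * ‖gradient φ x‖ ∂(interiorMeasure D) +
        ∫ x, φ x ^ 2 ∂(surfaceMeasure D) := by
    rw [div_mul_eq_mul_div, div_le_iff₀ hR, mul_comm _ (Metric.diam D / 2)]
    exact h
  nlinarith [mul_le_mul_of_nonneg_left h3 ht]

theorem IsSmoothBoundedDomain.smooth_explicit {d : ℕ} (hd : 1 ≤ d)
    {D : Set (EuclideanSpace ℝ (Fin d))} (hD : IsSmoothBoundedDomain D)
    {φ : EuclideanSpace ℝ (Fin d) → ℝ} (hφ : ContDiff ℝ ∞ φ) {θ : ℝ} (hθ : 0 ≤ θ) :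
    explicitConstant d (Metric.diam D / 2) θ * ∫ x, φ x ^ 2 ∂(interiorMeasure D) ≤
      ∫ x, ‖gradient φ x‖ ^ 2 ∂(interiorMeasure D) + θ * ∫ x, φ x ^ 2 ∂(surfaceMeasure D) := by
  have hR : 0 < Metric.diam D / 2 := half_pos (hD.diam_pos hd)
  rw [explicitConstant]
  split_ifs with h
  · exact hD.smooth_poincareTrace hd hφ hθ
  · set R := Metric.diam D / 2
    -- for large `θ`, the optimal parameter is the maximizer of `t (d / R - t)`
    have h1 := hD.smooth_poincareTrace hd hφ (t := d / (2 * R)) (by positivity)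
    have h2 : (d : ℝ) / (2 * R) * (d / R - d / (2 * R)) = d ^ 2 / (4 * R ^ 2) := by
      field_simp; ring
    rw [h2] at h1
    refine h1.trans ?_
    have : 0 ≤ ∫ x, φ x ^ 2 ∂(surfaceMeasure D) := integral_nonneg fun x => sq_nonneg _
    gcongr
    exact not_lt.1 h

theorem explicitConstant_pos {d : ℕ} (hd : 1 ≤ d) {R θ : ℝ} (hR : 0 < R) (hθ : 0 < θ) :
    0 < explicitConstant d R θ := by
  have hd' : (0 : ℝ) < d := by exact_mod_cast hd
  rw [explicitConstant]
  split_ifs with h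
  · refine mul_pos hθ (sub_pos.2 (h.trans_le ?_))
    gcongr
    linarith
  · positivity

/-! ### Approximation of the identity in `L²` -/

section Mollify

variable {d : ℕ} {F : Type*} [NormedAddCommGroup F]

theorem eLpNorm_two_sq {α G : Type*} [MeasurableSpace α] [NormedAddCommGroup G] (μ : Measure α)
    (f : α → G) : eLpNorm f 2 μ ^ 2 = ∫⁻ x, ‖f x‖ₑ ^ 2 ∂μ := by
  have := eLpNorm_nnreal_pow_eq_lintegral (μ := μ) (f := f) (p := 2) two_ne_zero
  simpa using this

/-- Translations are continuous in `L²`. -/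
theorem tendsto_eLpNorm_translate_sub {w : EuclideanSpace ℝ (Fin d) → F} (hw : MemLp w 2 volume) :
    Tendsto (fun t => eLpNorm (fun y => w (y - t) - w y) 2 volume) (𝓝 0) (𝓝 0) := by
  have hmp : ∀ t : EuclideanSpace ℝ (Fin d), MeasurePreserving (fun y => y - t) volume volume :=
    fun t => measurePreserving_sub_right volume t
  let g : EuclideanSpace ℝ (Fin d) → C(EuclideanSpace ℝ (Fin d), EuclideanSpace ℝ (Fin d)) :=
    fun t => ⟨fun y => y - t, by fun_prop⟩
  have hg : Continuous g := ContinuousMap.continuous_of_continuous_uncurry _ (by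
    change Continuous fun p : EuclideanSpace ℝ (Fin d) × EuclideanSpace ℝ (Fin d) => p.2 - p.1
    fun_prop)
  have h := Tendsto.compMeasurePreservingLp (μ := volume) (ν := volume) (l := 𝓝 0)
    (f := fun _ : EuclideanSpace ℝ (Fin d) => hw.toLp w) tendsto_const_nhds (hg.tendsto 0)
    hmp (hmp 0) (by simp)
  rw [tendsto_iff_edist_tendsto_0] at h
  refine h.congr fun t => ?_
  rw [Lp.edist_def]
  refine eLpNorm_congr_ae ?_
  have h1 := Lp.coeFn_compMeasurePreserving (hw.toLp w) (hmp t)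
  have h2 := Lp.coeFn_compMeasurePreserving (hw.toLp w) (hmp 0)
  have h3 := (hmp t).quasiMeasurePreserving.ae_eq_comp hw.coeFn_toLp
  have h4 := (hmp 0).quasiMeasurePreserving.ae_eq_comp hw.coeFn_toLp
  filter_upwards [h1, h2, h3, h4] with y h1 h2 h3 h4
  rw [Pi.sub_apply]
  exact congrArg₂ _ (h1.trans h3) (h2.trans (h4.trans (by simp)))

variable [NormedSpace ℝ F]

/-- The mollification of `w` by the kernel `k`, i.e. the convolution of `k` and `w`. -/
noncomputable def mollify (k : EuclideanSpace ℝ (Fin d) → ℝ) (w : EuclideanSpace ℝ (Fin d) → F) :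
    EuclideanSpace ℝ (Fin d) → F :=
  fun y => ∫ z, k (y - z) • w z

/-- A smooth probability density with compact support. -/
structure IsMollifier (k : EuclideanSpace ℝ (Fin d) → ℝ) : Prop where
  contDiff : ContDiff ℝ ∞ k
  hasCompactSupport : HasCompactSupport k
  nonneg : ∀ x, 0 ≤ k x
  integral_eq_one : ∫ x, k x = 1

theorem mollify_eq_convolution (k : EuclideanSpace ℝ (Fin d) → ℝ)
    (w : EuclideanSpace ℝ (Fin d) → F) :
    mollify k w = convolution w k (ContinuousLinearMap.lsmul ℝ ℝ).flip volume := rfl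

theorem mollify_eq_integral_translate (k : EuclideanSpace ℝ (Fin d) → ℝ)
    (w : EuclideanSpace ℝ (Fin d) → F) (y : EuclideanSpace ℝ (Fin d)) :
    mollify k w y = ∫ t, k t • w (y - t) := by
  rw [mollify, ← integral_sub_left_eq_self _ volume y]
  simp

theorem IsMollifier.integrable_smul {k : EuclideanSpace ℝ (Fin d) → ℝ} (hk : IsMollifier k)
    {w : EuclideanSpace ℝ (Fin d) → F} (hw : LocallyIntegrable w volume)
    (y : EuclideanSpace ℝ (Fin d)) : Integrable (fun z => k (y - z) • w z) volume :=
  hk.hasCompactSupport.convolutionExists_right (ContinuousLinearMap.lsmul ℝ ℝ).flip hw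
    hk.contDiff.continuous y

theorem IsMollifier.integrable_smul_translate {k : EuclideanSpace ℝ (Fin d) → ℝ}
    (hk : IsMollifier k) {w : EuclideanSpace ℝ (Fin d) → F} (hw : LocallyIntegrable w volume)
    (y : EuclideanSpace ℝ (Fin d)) : Integrable (fun t => k t • w (y - t)) volume := by
  have := (hk.integrable_smul hw y).comp_sub_left y
  simpa using this

theorem IsMollifier.contDiff_mollify {k : EuclideanSpace ℝ (Fin d) → ℝ} (hk : IsMollifier k)
    {w : EuclideanSpace ℝ (Fin d) → F} (hw : LocallyIntegrable w volume) :
    ContDiff ℝ ∞ (mollify k w) := by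
  rw [mollify_eq_convolution]
  exact hk.hasCompactSupport.contDiff_convolution_right _ hw hk.contDiff

variable [CompleteSpace F]

/-- Jensen's inequality and Tonelli's theorem: the mollification error is controlled by the
translation errors on the support of the kernel. -/
theorem IsMollifier.eLpNorm_mollify_sub_le {k : EuclideanSpace ℝ (Fin d) → ℝ} (hk : IsMollifier k)
    {w : EuclideanSpace ℝ (Fin d) → F} (hw : MemLp w 2 volume) {η : ℝ≥0∞}
    (hη : ∀ t, k t ≠ 0 → eLpNorm (fun y => w (y - t) - w y) 2 volume ≤ η) :
    eLpNorm (mollify k w - w) 2 volume ≤ η := by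
  have hwl : LocallyIntegrable w volume := hw.locallyIntegrable (by norm_num)
  have hkm : Measurable fun t => ENNReal.ofReal (k t) :=
    hk.contDiff.continuous.measurable.ennreal_ofReal
  have hki : Integrable k volume :=
    hk.contDiff.continuous.integrable_of_hasCompactSupport hk.hasCompactSupport
  have hk1 : ∫⁻ t, ENNReal.ofReal (k t) = 1 := by
    rw [← ofReal_integral_eq_lintegral_ofReal hki (Eventually.of_forall hk.nonneg),
      hk.integral_eq_one, ENNReal.ofReal_one]
  set ν := (volume : Measure (EuclideanSpace ℝ (Fin d))).withDensity
    fun t => ENNReal.ofReal (k t) with hν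
  have : IsProbabilityMeasure ν := ⟨by
    rw [hν, withDensity_apply _ MeasurableSet.univ, Measure.restrict_univ, hk1]⟩
  have hmeas2 : AEStronglyMeasurable
      (fun p : EuclideanSpace ℝ (Fin d) × EuclideanSpace ℝ (Fin d) => w (p.1 - p.2) - w p.1)
      (volume.prod volume) :=
    (hw.1.comp_quasiMeasurePreserving
      (quasiMeasurePreserving_sub volume volume)).sub hw.1.comp_fst
  have hac : (volume : Measure (EuclideanSpace ℝ (Fin d))).prod ν ≪ volume.prod volume :=
    Measure.AbsolutelyContinuous.rfl.prod (withDensity_absolutelyContinuous _ _)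
  have hpt : ∀ y, ‖(mollify k w - w) y‖ₑ ^ 2 ≤ ∫⁻ t, ‖w (y - t) - w y‖ₑ ^ 2 ∂ν := by
    intro y
    have h1 : (mollify k w - w) y = ∫ t, k t • (w (y - t) - w y) := by
      simp only [smul_sub]
      rw [integral_sub (hk.integrable_smul_translate hwl y) (hki.smul_const _),
        integral_smul_const, hk.integral_eq_one, one_smul, Pi.sub_apply,
        mollify_eq_integral_translate]
    have hym : AEStronglyMeasurable (fun t => w (y - t) - w y) ν := by
      refine AEStronglyMeasurable.mono_ac (withDensity_absolutelyContinuous _ _) ?_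
      exact (hw.1.comp_quasiMeasurePreserving
        (quasiMeasurePreserving_sub_left volume y)).sub aestronglyMeasurable_const
    have h2 : ‖(mollify k w - w) y‖ₑ ≤ eLpNorm (fun t => w (y - t) - w y) 1 ν := by
      rw [h1, eLpNorm_one_eq_lintegral_enorm, hν,
        lintegral_withDensity_eq_lintegral_mul_non_measurable]
      · refine (enorm_integral_le_lintegral_enorm _).trans (le_of_eq ?_)
        refine lintegral_congr fun t => ?_
        rw [enorm_smul, Pi.mul_apply, Real.enorm_of_nonneg (hk.nonneg t)]
      · exact hkm
      · exact Eventually.of_forall fun t => ENNReal.ofReal_lt_top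
    rw [← eLpNorm_two_sq]
    gcongr
    exact h2.trans (eLpNorm_le_eLpNorm_of_exponent_le (by norm_num) hym)
  have hsq : eLpNorm (mollify k w - w) 2 volume ^ 2 ≤ η ^ 2 := by
    rw [eLpNorm_two_sq]
    calc ∫⁻ y, ‖(mollify k w - w) y‖ₑ ^ 2 ≤ ∫⁻ y, ∫⁻ t, ‖w (y - t) - w y‖ₑ ^ 2 ∂ν :=
          lintegral_mono hpt
      _ = ∫⁻ t, (∫⁻ y, ‖w (y - t) - w y‖ₑ ^ 2) ∂ν :=
          lintegral_lintegral_swap ((hmeas2.mono_ac hac).enorm.pow_const 2)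
      _ ≤ ∫⁻ _, η ^ 2 ∂ν := by
          refine lintegral_mono_ae ?_
          rw [hν, ae_withDensity_iff hkm]
          refine Eventually.of_forall fun t ht => ?_
          rw [← eLpNorm_two_sq]
          gcongr
          exact hη t fun h0 => ht (by simp [h0])
      _ = η ^ 2 := by simp
  exact (ENNReal.pow_le_pow_left_iff two_ne_zero).1 hsq

theorem tendsto_eLpNorm_mollify_sub {ι : Type*} {l : Filter ι}
    {k : ι → EuclideanSpace ℝ (Fin d) → ℝ} (hk : ∀ᶠ i in l, IsMollifier (k i))
    (hs : ∀ ρ > 0, ∀ᶠ i in l, ∀ t, k i t ≠ 0 → ‖t‖ < ρ)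
    {w : EuclideanSpace ℝ (Fin d) → F} (hw : MemLp w 2 volume) :
    Tendsto (fun i => eLpNorm (mollify (k i) w - w) 2 volume) l (𝓝 0) := by
  rw [ENNReal.tendsto_nhds_zero]
  intro η hη
  obtain ⟨ρ, hρ, h⟩ := Metric.eventually_nhds_iff.1
    ((ENNReal.tendsto_nhds_zero.1 (tendsto_eLpNorm_translate_sub hw)) η hη)
  filter_upwards [hk, hs ρ hρ] with i hi hsi
  exact hi.eLpNorm_mollify_sub_le hw fun t ht => h (by simpa using hsi t ht)

/-- The mollifier concentrated on the ball of radius `τ / 2` around `τ n`. -/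
theorem exists_isMollifier (n : EuclideanSpace ℝ (Fin d)) {τ : ℝ} (hτ : 0 < τ) :
    ∃ k, IsMollifier k ∧ ∀ t, t ∈ tsupport k → ‖t - τ • n‖ ≤ τ / 2 := by
  let b : ContDiffBump (τ • n) := ⟨τ / 4, τ / 2, by positivity, by linarith⟩
  refine ⟨b.normed volume, ⟨b.contDiff_normed, b.hasCompactSupport_normed, b.nonneg_normed,
    b.integral_normed⟩, fun t ht => ?_⟩
  rw [b.tsupport_normed_eq, Metric.mem_closedBall, dist_eq_norm] at ht
  exact ht

theorem IsMollifier.fderiv_mollify_apply {k : EuclideanSpace ℝ (Fin d) → ℝ} (hk : IsMollifier k)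
    {w : EuclideanSpace ℝ (Fin d) → ℝ} (hw : LocallyIntegrable w volume)
    (y v : EuclideanSpace ℝ (Fin d)) :
    fderiv ℝ (mollify k w) y v = ∫ z, fderiv ℝ k (y - z) v * w z := by
  rw [mollify_eq_convolution, (hk.hasCompactSupport.hasFDerivAt_convolution_right _ hw
    (hk.contDiff.of_le (by simp)) y).fderiv, convolution_precompR_apply _ hw
    (hk.hasCompactSupport.fderiv ℝ) (hk.contDiff.continuous_fderiv (by simp))]
  rfl

end Mollify

/-! ### Density of smooth functions in `H¹(D)` -/

/-- The pair `(w, H)` is an `L²(D)`-limit of pairs `(φ, ∇φ)` with `φ` smooth on the whole space. -/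
def IsSmoothLimit {d : ℕ} (D : Set (EuclideanSpace ℝ (Fin d))) (w : EuclideanSpace ℝ (Fin d) → ℝ)
    (H : EuclideanSpace ℝ (Fin d) → EuclideanSpace ℝ (Fin d)) : Prop :=
  ∃ φ : ℕ → EuclideanSpace ℝ (Fin d) → ℝ, (∀ n, ContDiff ℝ ∞ (φ n)) ∧
    Tendsto (fun n => eLpNorm (fun x => φ n x - w x) 2 (interiorMeasure D)) atTop (𝓝 0) ∧
    Tendsto (fun n => eLpNorm (fun x => gradient (φ n) x - H x) 2 (interiorMeasure D)) atTop (𝓝 0)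

section Density

variable {d : ℕ} {D : Set (EuclideanSpace ℝ (Fin d))}

theorem gradient_add {φ ψ : EuclideanSpace ℝ (Fin d) → ℝ} (hφ : Differentiable ℝ φ)
    (hψ : Differentiable ℝ ψ) (x : EuclideanSpace ℝ (Fin d)) :
    gradient (φ + ψ) x = gradient φ x + gradient ψ x := by
  simp [gradient, fderiv_add (hφ x) (hψ x)]

theorem gradient_sub {φ ψ : EuclideanSpace ℝ (Fin d) → ℝ} (hφ : Differentiable ℝ φ)
    (hψ : Differentiable ℝ ψ) (x : EuclideanSpace ℝ (Fin d)) :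
    gradient (φ - ψ) x = gradient φ x - gradient ψ x := by
  simp [gradient, fderiv_sub (hφ x) (hψ x)]

theorem inner_gradient {φ : EuclideanSpace ℝ (Fin d) → ℝ} (x v : EuclideanSpace ℝ (Fin d)) :
    inner ℝ (gradient φ x) v = fderiv ℝ φ x v := by
  simp [gradient]

theorem IsSmoothLimit.add {w₁ w₂ : EuclideanSpace ℝ (Fin d) → ℝ}
    {H₁ H₂ : EuclideanSpace ℝ (Fin d) → EuclideanSpace ℝ (Fin d)}
    (h₁ : IsSmoothLimit D w₁ H₁) (h₂ : IsSmoothLimit D w₂ H₂)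
    (hw₁ : MemLp w₁ 2 (interiorMeasure D)) (hw₂ : MemLp w₂ 2 (interiorMeasure D))
    (hH₁ : MemLp H₁ 2 (interiorMeasure D)) (hH₂ : MemLp H₂ 2 (interiorMeasure D)) :
    IsSmoothLimit D (w₁ + w₂) (H₁ + H₂) := by
  obtain ⟨φ, hφ, a₁, b₁⟩ := h₁
  obtain ⟨ψ, hψ, a₂, b₂⟩ := h₂
  refine ⟨fun n => φ n + ψ n, fun n => (hφ n).add (hψ n), ?_, ?_⟩
  · refine tendsto_of_tendsto_of_tendsto_of_le_of_le tendsto_const_nhds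
      (by simpa using a₁.add a₂) (fun _ => zero_le) fun n => ?_
    refine le_trans (le_of_eq ?_) (eLpNorm_add_le
      ((hφ n).continuous.aestronglyMeasurable.sub hw₁.1)
      ((hψ n).continuous.aestronglyMeasurable.sub hw₂.1) (by norm_num))
    congr 1
    ext x
    simp only [Pi.add_apply]
    ring
  · refine tendsto_of_tendsto_of_tendsto_of_le_of_le tendsto_const_nhds
      (by simpa using b₁.add b₂) (fun _ => zero_le) fun n => ?_
    refine le_trans (le_of_eq ?_) (eLpNorm_add_le
      ((continuous_gradient (hφ n)).aestronglyMeasurable.sub hH₁.1)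
      ((continuous_gradient (hψ n)).aestronglyMeasurable.sub hH₂.1) (by norm_num))
    congr 1
    ext1 x
    rw [gradient_add ((hφ n).differentiable (by simp)) ((hψ n).differentiable (by simp))]
    simp only [Pi.add_apply]
    abel

theorem memLp_cutoff_mul {χ : EuclideanSpace ℝ (Fin d) → ℝ} (hχ : IsCutoff Set.univ χ)
    {μ : Measure (EuclideanSpace ℝ (Fin d))} {F : Type*} [NormedAddCommGroup F] [NormedSpace ℝ F]
    {u : EuclideanSpace ℝ (Fin d) → F} (hu : MemLp u 2 μ) : MemLp (fun x => χ x • u x) 2 μ := by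
  obtain ⟨C, hC⟩ := hχ.hasCompactSupport.exists_bound_of_continuous hχ.contDiff.continuous
  refine hu.of_le_mul (c := C) (hχ.contDiff.continuous.aestronglyMeasurable.smul hu.1)
    (Eventually.of_forall fun x => ?_)
  rw [norm_smul]
  gcongr
  exact hC x

theorem memLp_mul_gradient_cutoff {χ : EuclideanSpace ℝ (Fin d) → ℝ} (hχ : IsCutoff Set.univ χ)
    {μ : Measure (EuclideanSpace ℝ (Fin d))}
    {u : EuclideanSpace ℝ (Fin d) → ℝ} (hu : MemLp u 2 μ) :
    MemLp (fun x => u x • gradient χ x) 2 μ := by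
  obtain ⟨C, hC⟩ := (hχ.hasCompactSupport.fderiv ℝ).exists_bound_of_continuous
    (hχ.contDiff.continuous_fderiv (by simp))
  refine hu.of_le_mul (c := C)
    (hu.1.smul (continuous_gradient hχ.contDiff).aestronglyMeasurable)
    (Eventually.of_forall fun x => ?_)
  rw [norm_smul, mul_comm, norm_gradient_eq]
  gcongr
  exact hC x

/-- If the kernel, reflected and moved to `y`, only sees points of `D` on the support of the cutoff
`χ`, then mollification commutes with the weak gradient of `χ u` at `y`: the function
`z ↦ χ z * k (y - z)` is then a test function on `D`. -/
theorem IsWeakGradient.gradient_mollify (hD : IsSmoothBoundedDomain D)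
    {u : EuclideanSpace ℝ (Fin d) → ℝ} {G : EuclideanSpace ℝ (Fin d) → EuclideanSpace ℝ (Fin d)}
    (hu : MemLp u 2 (interiorMeasure D)) (hG : MemLp G 2 (interiorMeasure D))
    (huG : IsWeakGradient D u G) {χ k : EuclideanSpace ℝ (Fin d) → ℝ}
    (hχ : IsCutoff Set.univ χ) (hk : IsMollifier k) {y : EuclideanSpace ℝ (Fin d)}
    (hy : ∀ z ∈ tsupport χ, y - z ∈ tsupport k → z ∈ D) :
    gradient (mollify k (D.indicator fun x => χ x • u x)) y =
      mollify k (D.indicator fun x => χ x • G x + u x • gradient χ x) y := by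
  have hDm := hD.isOpen.measurableSet
  have hw : MemLp (D.indicator fun x => χ x • u x) 2 volume :=
    (memLp_indicator_iff_restrict hDm).2 (memLp_cutoff_mul hχ hu)
  have hH : MemLp (D.indicator fun x => χ x • G x + u x • gradient χ x) 2 volume :=
    (memLp_indicator_iff_restrict hDm).2
      ((memLp_cutoff_mul hχ hG).add (memLp_mul_gradient_cutoff hχ hu))
  have hwl := hw.locallyIntegrable (by norm_num : (1 : ℝ≥0∞) ≤ 2)
  have hHl := hH.locallyIntegrable (by norm_num : (1 : ℝ≥0∞) ≤ 2)
  have hky : ContDiff ℝ ∞ fun z => k (y - z) := hk.contDiff.comp (contDiff_const.sub contDiff_id)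
  set ψ : EuclideanSpace ℝ (Fin d) → ℝ := χ * fun z => k (y - z) with hψ
  have hψc : ContDiff ℝ ∞ ψ := hχ.contDiff.mul hky
  have hψs : HasCompactSupport ψ := hχ.hasCompactSupport.mul_right
  have hψD : tsupport ψ ⊆ D := fun z hz =>
    hy z (tsupport_mul_subset_left hz) (tsupport_comp_subset_preimage k
      (continuous_const.sub continuous_id) (tsupport_mul_subset_right hz))
  refine ext_inner_right ℝ fun v => ?_
  rw [inner_gradient, hk.fderiv_mollify_apply hwl]
  have hdψ : ∀ z, fderiv ℝ ψ z v =
      fderiv ℝ χ z v * k (y - z) - χ z * fderiv ℝ k (y - z) v := fun z => by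
    have h1 : HasFDerivAt (fun z => k (y - z)) (-(fderiv ℝ k (y - z))) z := by
      have := (hk.contDiff.differentiable (by simp) (y - z)).hasFDerivAt.comp z
        ((hasFDerivAt_id z).const_sub y)
      refine this.congr_fderiv ?_
      ext v; simp
    have h2 := (hχ.contDiff.differentiable (by simp) z).hasFDerivAt.mul h1
    rw [hψ, h2.fderiv]
    simp
    ring
  have hkc : Continuous fun z => k (y - z) := hky.continuous
  have hdkc : Continuous fun z => fderiv ℝ k (y - z) v :=
    ((hk.contDiff.continuous_fderiv (by simp)).comp (continuous_const.sub continuous_id)).clm_apply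
      continuous_const
  have hdχc : Continuous fun z => fderiv ℝ χ z v :=
    (hχ.contDiff.continuous_fderiv (by simp)).clm_apply continuous_const
  have hint : ∀ {f : EuclideanSpace ℝ (Fin d) → ℝ}, Continuous f →
      Integrable (fun z => u z * f z) (volume.restrict D) := fun {f} hf =>
    hu.integrable_mul (hD.memLp_interiorMeasure hf 2)
  have hGv : MemLp (fun z => inner ℝ (G z) v) 2 (interiorMeasure D) :=
    hG.inner_const v
  have hweak := huG ψ hψc hψs hψD v
  have e1 : ∫ z, fderiv ℝ k (y - z) v * D.indicator (fun x => χ x • u x) z =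
      ∫ z in D, u z * (χ z * fderiv ℝ k (y - z) v) := by
    rw [← integral_indicator hDm]
    refine integral_congr_ae (Eventually.of_forall fun z => ?_)
    by_cases hz : z ∈ D <;> simp [hz]
    ring
  have e2 : inner ℝ (mollify k (D.indicator fun x => χ x • G x + u x • gradient χ x) y) v =
      ∫ z in D, (inner ℝ (G z) v * ψ z + u z * (fderiv ℝ χ z v * k (y - z))) := by
    rw [real_inner_comm, mollify, ← integral_inner (hk.integrable_smul hHl y),
      ← integral_indicator hDm]
    refine integral_congr_ae (Eventually.of_forall fun z => ?_)
    by_cases hz : z ∈ D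
    · simp only [hz, Set.indicator_of_mem, inner_smul_right, inner_add_right, hψ, Pi.mul_apply]
      rw [real_inner_comm v (G z), ← real_inner_comm v (gradient χ z), inner_gradient]
      ring
    · simp [hz]
  have i1 : Integrable (fun z => u z * (fderiv ℝ χ z v * k (y - z))) (volume.restrict D) :=
    hint (f := fun z => fderiv ℝ χ z v * k (y - z)) (hdχc.mul hkc)
  have i2 : Integrable (fun z => u z * (χ z * fderiv ℝ k (y - z) v)) (volume.restrict D) :=
    hint (f := fun z => χ z * fderiv ℝ k (y - z) v) (hχ.contDiff.continuous.mul hdkc)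
  have e3 : ∫ z in D, u z * fderiv ℝ ψ z v = (∫ z in D, u z * (fderiv ℝ χ z v * k (y - z))) -
      ∫ z in D, u z * (χ z * fderiv ℝ k (y - z) v) := by
    rw [← integral_sub i1 i2]
    refine integral_congr_ae (Eventually.of_forall fun z => ?_)
    simp only [hdψ]
    ring
  have i4 : Integrable (fun z => inner ℝ (G z) v * ψ z) (volume.restrict D) :=
    hGv.integrable_mul (hD.memLp_interiorMeasure hψc.continuous 2)
  rw [e1, e2, integral_add i4 i1]
  linarith

/-- If `z + e ∈ D` forces `z ∈ D` for `z ∈ U` and all small displacements `e` in a cone around `n`,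
then mollifying from the side of `n` approximates `χ u` for cutoffs `χ` supported in `U`. -/
theorem IsWeakGradient.isSmoothLimit_cutoff (hD : IsSmoothBoundedDomain D)
    {u : EuclideanSpace ℝ (Fin d) → ℝ} {G : EuclideanSpace ℝ (Fin d) → EuclideanSpace ℝ (Fin d)}
    (hu : MemLp u 2 (interiorMeasure D)) (hG : MemLp G 2 (interiorMeasure D))
    (huG : IsWeakGradient D u G) {U : Set (EuclideanSpace ℝ (Fin d))}
    {n : EuclideanSpace ℝ (Fin d)} {τ₀ : ℝ} (hτ₀ : 0 < τ₀)
    (hcone : ∀ τ, 0 < τ → τ < τ₀ → ∀ e, ‖e - τ • n‖ ≤ τ / 2 → ∀ z ∈ U, z + e ∈ D → z ∈ D)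
    {χ : EuclideanSpace ℝ (Fin d) → ℝ} (hχU : IsCutoff U χ) :
    IsSmoothLimit D (fun x => χ x • u x) (fun x => χ x • G x + u x • gradient χ x) := by
  have hDm := hD.isOpen.measurableSet
  have hχ : IsCutoff Set.univ χ := hχU.mono (Set.subset_univ _)
  have hw : MemLp (D.indicator fun x => χ x • u x) 2 volume :=
    (memLp_indicator_iff_restrict hDm).2 (memLp_cutoff_mul hχ hu)
  have hH : MemLp (D.indicator fun x => χ x • G x + u x • gradient χ x) 2 volume :=
    (memLp_indicator_iff_restrict hDm).2
      ((memLp_cutoff_mul hχ hG).add (memLp_mul_gradient_cutoff hχ hu))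
  choose! k hk hks using fun (τ : ℝ) (hτ : 0 < τ) => exists_isMollifier n hτ
  -- kernels concentrated near `τ n` with `0 < τ < τ₀` and `τ → 0`
  set τ : ℕ → ℝ := fun m => τ₀ * ((m : ℝ) + 2)⁻¹ with hτ
  have hτpos : ∀ m, 0 < τ m := fun m => by positivity
  have hτlt : ∀ m, τ m < τ₀ := fun m => by
    refine mul_lt_of_lt_one_right hτ₀ (inv_lt_one_of_one_lt₀ ?_)
    have : (0 : ℝ) ≤ m := m.cast_nonneg
    linarith
  have hτ0 : Tendsto τ atTop (𝓝 0) := by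
    have : Tendsto (fun m : ℕ => ((m : ℝ) + 2)⁻¹) atTop (𝓝 0) :=
      tendsto_inv_atTop_zero.comp (tendsto_atTop_add_const_right _ _ tendsto_natCast_atTop_atTop)
    simpa using this.const_mul τ₀
  have hsmall : ∀ ρ > 0, ∀ᶠ m in atTop, ∀ t, k (τ m) t ≠ 0 → ‖t‖ < ρ := fun ρ hρ => by
    have h1 : Tendsto (fun m => τ m * (‖n‖ + 1)) atTop (𝓝 0) := by
      simpa using hτ0.mul_const (‖n‖ + 1)
    filter_upwards [h1.eventually (gt_mem_nhds hρ)] with m hm t ht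
    have h2 := hks (τ m) (hτpos m) t (subset_tsupport _ ht)
    have h3 : ‖t‖ ≤ ‖t - τ m • n‖ + ‖τ m • n‖ := by
      simpa using norm_add_le (t - τ m • n) (τ m • n)
    rw [norm_smul, Real.norm_of_nonneg (hτpos m).le] at h3
    linarith [hτpos m]
  have hmoll : ∀ᶠ m in atTop, IsMollifier (k (τ m)) := Eventually.of_forall fun m => hk _ (hτpos m)
  refine ⟨fun m => mollify (k (τ m)) (D.indicator fun x => χ x • u x), fun m =>
    (hk _ (hτpos m)).contDiff_mollify (hw.locallyIntegrable (by norm_num)), ?_, ?_⟩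
  · refine tendsto_of_tendsto_of_tendsto_of_le_of_le tendsto_const_nhds
      (tendsto_eLpNorm_mollify_sub hmoll hsmall hw) (fun _ => zero_le) fun m => ?_
    refine le_trans (le_of_eq (eLpNorm_congr_ae ?_))
      (eLpNorm_mono_measure _ Measure.restrict_le_self)
    filter_upwards [ae_restrict_mem hDm] with x hx
    simp [hx]
  · refine tendsto_of_tendsto_of_tendsto_of_le_of_le tendsto_const_nhds
      (tendsto_eLpNorm_mollify_sub hmoll hsmall hH) (fun _ => zero_le) fun m => ?_
    refine le_trans (le_of_eq (eLpNorm_congr_ae ?_))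
      (eLpNorm_mono_measure _ Measure.restrict_le_self)
    filter_upwards [ae_restrict_mem hDm] with x hx
    rw [huG.gradient_mollify hD hu hG hχ (hk _ (hτpos m)) (y := x) fun z hz hxz =>
      hcone (τ m) (hτpos m) (hτlt m) (x - z) (hks _ (hτpos m) _ hxz) z (hχU.tsupport_subset hz)
        (by simpa using hx)]
    simp [hx]

/-- Outward displacements in a cone around the normal leave the part of `D` below a graph only
from points of `D`. -/
theorem IsGraphChart.mem_of_add_mem {κ : ℝ≥0} {x₀ n : EuclideanSpace ℝ (Fin d)} {a : ℝ}
    {g : (ℝ ∙ n)ᗮ → ℝ} (h : IsGraphChart D κ x₀ n a g) (hκ : κ ≤ 1 / 2) {τ : ℝ} (hτ : 0 < τ)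
    (hτa : τ < a / 3) {e : EuclideanSpace ℝ (Fin d)} (he : ‖e - τ • n‖ ≤ τ / 2)
    {z : EuclideanSpace ℝ (Fin d)} (hz : z ∈ cylinder x₀ n (a / 2)) (hze : z + e ∈ D) : z ∈ D := by
  have hκ2 : (κ : ℝ) ≤ 1 / 2 := by exact_mod_cast hκ
  have hz1 := chartPoint_proj_height (x₀ := x₀) h.norm_eq z
  set p := chartProj x₀ n z
  set s := chartHeight x₀ n z
  have hz2 : z + τ • n = chartPoint x₀ n p (s + τ) := by
    rw [← hz1, chartPoint, chartPoint, add_smul, ← add_assoc]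
  have h1 := norm_chartProj_sub_le (x₀ := x₀) (n := n) (z + e) (z + τ • n)
  have h2 := abs_chartHeight_sub_le (x₀ := x₀) h.norm_eq (z + e) (z + τ • n)
  rw [add_sub_add_left_eq_sub, hz2, chartProj_chartPoint] at h1
  rw [add_sub_add_left_eq_sub, hz2, chartHeight_chartPoint h.norm_eq] at h2
  have h3 := _root_.abs_le.1 (h2.trans he)
  have hp : ‖p‖ < a / 2 := hz.1
  have hs := _root_.abs_lt.1 (hz.2 : |s| < a / 2)
  have hp' : ‖chartProj x₀ n (z + e)‖ < a := by
    have := norm_add_le (chartProj x₀ n (z + e) - p) p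
    rw [sub_add_cancel] at this
    linarith
  have hs' : |chartHeight x₀ n (z + e)| < a := by
    rw [_root_.abs_lt]
    constructor <;> linarith
  rw [← chartPoint_proj_height (x₀ := x₀) h.norm_eq (z + e), h.mem_iff _ _ hp' hs'] at hze
  have h4 := h.sub_le (chartProj x₀ n (z + e)) p
  have h5 : (κ : ℝ) * ‖chartProj x₀ n (z + e) - p‖ ≤ 1 / 2 * (τ / 2) :=
    mul_le_mul hκ2 (h1.trans he) (norm_nonneg _) (by norm_num)
  rw [← hz1, h.mem_iff p s (by linarith [h.pos]) 
    (_root_.abs_lt.2 ⟨by linarith [h.pos], by linarith [h.pos]⟩)]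
  linarith

/-- Smooth functions are dense in `H¹(D)`: a partition of unity reduces to cutoffs supported in `D`,
where the direction of mollification is irrelevant, or in a boundary chart. -/
theorem IsWeakGradient.isSmoothLimit (hD : IsSmoothBoundedDomain D)
    {u : EuclideanSpace ℝ (Fin d) → ℝ} {G : EuclideanSpace ℝ (Fin d) → EuclideanSpace ℝ (Fin d)}
    (hu : MemLp u 2 (interiorMeasure D)) (hG : MemLp G 2 (interiorMeasure D))
    (huG : IsWeakGradient D u G) : IsSmoothLimit D u G := by
  have key : ∃ U, IsOpen U ∧ closure D ⊆ U ∧ ∀ χ, IsCutoff U χ →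
      IsSmoothLimit D (fun x => χ x • u x) (fun x => χ x • G x + u x • gradient χ x) := by
    refine exists_isOpen_forall_isCutoff hD.isBounded.isCompact_closure ?_ ?_ fun x hx => ?_
    · exact ⟨fun _ => 0, fun _ => contDiff_const, by simp, by simp [gradient]⟩
    · intro χ₁ χ₂ h₁ h₂ hQ₁ hQ₂
      have := hQ₁.add hQ₂ (memLp_cutoff_mul h₁ hu) (memLp_cutoff_mul h₂ hu)
        ((memLp_cutoff_mul h₁ hG).add (memLp_mul_gradient_cutoff h₁ hu))
        ((memLp_cutoff_mul h₂ hG).add (memLp_mul_gradient_cutoff h₂ hu))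
      convert this using 1
      · ext x
        simp [add_mul]
      · ext1 x
        rw [gradient_add (h₁.contDiff.differentiable (by simp))
          (h₂.contDiff.differentiable (by simp))]
        simp only [Pi.add_apply, add_smul, smul_add]
        abel
    · by_cases hxD : x ∈ D
      · exact ⟨D, hD.isOpen, hxD, fun χ hχ => huG.isSmoothLimit_cutoff hD hu hG (n := 0)
          one_pos (fun _ _ _ _ _ z hz _ => hz) hχ⟩
      · obtain ⟨n, a, g, h⟩ := exists_isGraphChart hD.isOpen hD.smooth
          (hD.isOpen.frontier_eq ▸ ⟨hx, hxD⟩ : x ∈ frontier D) (κ := 1 / 2) (by positivity) le_rfl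
        have ha := h.pos
        exact ⟨_, isOpen_cylinder (a / 2), mem_cylinder_self (half_pos ha), fun χ hχ =>
          huG.isSmoothLimit_cutoff hD hu hG (by positivity : 0 < a / 3)
            (fun τ hτ hτa e he z hz hze => h.mem_of_add_mem le_rfl hτ hτa he hz hze) hχ⟩
  obtain ⟨U, hU, hDU, hQ⟩ := key
  obtain ⟨χ, hχ, -, hχ1⟩ := exists_isCutoff_eq_one hD.isBounded.isCompact_closure hU hDU
  obtain ⟨φ, hφ, h1, h2⟩ := hQ χ hχ
  have hev : ∀ x ∈ D, χ =ᶠ[𝓝 x] fun _ => 1 := fun x hx =>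
    hχ1.filter_mono (nhds_le_nhdsSet (subset_closure hx))
  refine ⟨φ, hφ, h1.congr fun n => eLpNorm_congr_ae ?_, h2.congr fun n => eLpNorm_congr_ae ?_⟩
  · filter_upwards [ae_restrict_mem hD.isOpen.measurableSet] with x hx
    simp [(hev x hx).self_of_nhds]
  · filter_upwards [ae_restrict_mem hD.isOpen.measurableSet] with x hx
    simp [(hev x hx).self_of_nhds, gradient, (hev x hx).fderiv_eq]

end Density

/-! ### Traces of `H¹` functions -/

section Trace

variable {d : ℕ} {D : Set (EuclideanSpace ℝ (Fin d))}

theorem MemH1.memLp_weakGradient {u : EuclideanSpace ℝ (Fin d) → ℝ} (hu : MemH1 D u) :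
    MemLp (weakGradient D u) 2 (interiorMeasure D) := by
  rw [weakGradient, dif_pos hu.2]
  exact hu.2.choose_spec.1

theorem MemH1.isWeakGradient_weakGradient {u : EuclideanSpace ℝ (Fin d) → ℝ} (hu : MemH1 D u) :
    IsWeakGradient D u (weakGradient D u) := by
  rw [weakGradient, dif_pos hu.2]
  exact hu.2.choose_spec.2

/-- The trace inequality for smooth functions, in terms of `L²` norms. -/
theorem IsSmoothBoundedDomain.exists_eLpNorm_surfaceMeasure_le (hD : IsSmoothBoundedDomain D) :
    ∃ C : ℝ≥0, ∀ φ : EuclideanSpace ℝ (Fin d) → ℝ, ContDiff ℝ ∞ φ →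
      eLpNorm φ 2 (surfaceMeasure D) ≤
        C * (eLpNorm φ 2 (interiorMeasure D) + eLpNorm (gradient φ) 2 (interiorMeasure D)) := by
  obtain ⟨C, hC⟩ := hD.exists_lintegral_surfaceMeasure_le
  refine ⟨C + 1, fun φ hφ => ?_⟩
  have h1 := hC φ (hφ.of_le (by norm_cast))
  have hsq : ∀ r : ℝ, ENNReal.ofReal (r ^ 2) = ‖r‖ₑ ^ 2 := fun r => by
    rw [← sq_abs, ENNReal.ofReal_pow (abs_nonneg r), ← Real.norm_eq_abs, ofReal_norm]
  have h2 : ∀ x, ENNReal.ofReal (φ x ^ 2 + ‖fderiv ℝ φ x‖ ^ 2) =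
      ‖φ x‖ₑ ^ 2 + ‖gradient φ x‖ₑ ^ 2 := fun x => by
    rw [ENNReal.ofReal_add (sq_nonneg _) (sq_nonneg _), hsq, ← norm_gradient_eq,
      ENNReal.ofReal_pow (norm_nonneg _), ofReal_norm]
  simp only [hsq, h2] at h1
  rw [lintegral_add_left (hφ.continuous.enorm.measurable.pow_const 2), ← eLpNorm_two_sq, ← eLpNorm_two_sq (volume.restrict D),
    ← eLpNorm_two_sq (volume.restrict D)] at h1
  change _ ≤ (C : ℝ≥0∞) * (eLpNorm φ 2 (interiorMeasure D) ^ 2 +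
    eLpNorm (gradient φ) 2 (interiorMeasure D) ^ 2) at h1
  set a := eLpNorm φ 2 (interiorMeasure D)
  set b := eLpNorm (gradient φ) 2 (interiorMeasure D)
  refine (ENNReal.pow_le_pow_left_iff two_ne_zero).1 (h1.trans ?_)
  rw [mul_pow]
  refine mul_le_mul' ?_ ?_
  · push_cast
    calc (C : ℝ≥0∞) ≤ C + 1 := le_self_add
      _ ≤ (C + 1) ^ 2 := le_self_pow₀ le_add_self (by norm_num)
  · rw [add_sq]
    exact add_le_add_left le_self_add _

/-- The boundary values of a smooth approximating sequence are Cauchy in `L²(∂D)`. -/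
theorem MemH1.exists_isTrace (hD : IsSmoothBoundedDomain D) {u : EuclideanSpace ℝ (Fin d) → ℝ}
    (hu : MemH1 D u) : ∃ g, IsTrace D u g := by
  obtain ⟨φ, hφ, h1, h2⟩ :=
    hu.isWeakGradient_weakGradient.isSmoothLimit hD hu.1 hu.memLp_weakGradient
  obtain ⟨C, hC⟩ := hD.exists_eLpNorm_surfaceMeasure_le
  set G := weakGradient D u
  set a := fun n => eLpNorm (fun x => φ n x - u x) 2 (interiorMeasure D)
  set b := fun n => eLpNorm (fun x => gradient (φ n) x - G x) 2 (interiorMeasure D)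
  have hm : ∀ n, MemLp (φ n) 2 (surfaceMeasure D) := fun n =>
    hD.memLp_surfaceMeasure (hφ n).continuous 2
  have hdist : ∀ m n, edist ((hm m).toLp (φ m)) ((hm n).toLp (φ n)) ≤
      C * ((a m + b m) + (a n + b n)) := fun m n => by
    rw [Lp.edist_toLp_toLp]
    refine (hC _ ((hφ m).sub (hφ n))).trans ?_
    have e1 : eLpNorm (φ m - φ n) 2 (interiorMeasure D) ≤ a m + a n := by
      refine le_trans (le_of_eq ?_) (eLpNorm_sub_le ((hφ m).continuous.aestronglyMeasurable.sub
        hu.1.1) ((hφ n).continuous.aestronglyMeasurable.sub hu.1.1) (by norm_num))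
      congr 1
      ext x
      simp
    have e2 : eLpNorm (gradient (φ m - φ n)) 2 (interiorMeasure D) ≤ b m + b n := by
      refine le_trans (le_of_eq ?_) (eLpNorm_sub_le
        ((continuous_gradient (hφ m)).aestronglyMeasurable.sub hu.memLp_weakGradient.1)
        ((continuous_gradient (hφ n)).aestronglyMeasurable.sub hu.memLp_weakGradient.1)
        (by norm_num))
      congr 1
      ext1 x
      rw [gradient_sub ((hφ m).differentiable (by simp)) ((hφ n).differentiable (by simp))]
      simp
    refine mul_le_mul_right (α := ℝ≥0∞) ((add_le_add e1 e2).trans (le_of_eq ?_)) _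
    abel
  have hcauchy : CauchySeq fun n => (hm n).toLp (φ n) := by
    have h0 : Tendsto (fun n => (C : ℝ≥0∞) * (a n + b n)) atTop (𝓝 0) := by
      have := ENNReal.Tendsto.const_mul (a := (C : ℝ≥0∞)) (h1.add h2)
        (Or.inr ENNReal.coe_ne_top)
      simpa using this
    refine EMetric.cauchySeq_iff.2 fun ε hε => ?_
    obtain ⟨N, hN⟩ := eventually_atTop.1 (h0.eventually (gt_mem_nhds (ENNReal.half_pos hε.ne')))
    refine ⟨N, fun m hm' n hn' => (hdist m n).trans_lt ?_⟩
    rw [mul_add, ← ENNReal.add_halves ε]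
    exact ENNReal.add_lt_add (hN m hm') (hN n hn')
  obtain ⟨g, hg⟩ := cauchySeq_tendsto_of_complete hcauchy
  refine ⟨g, Lp.memLp g, φ, hφ, h1, h2, ?_⟩
  have := (Lp.tendsto_Lp_iff_tendsto_eLpNorm'' φ hm g (Lp.memLp g)).1
    (by rwa [Lp.toLp_coeFn])
  exact this

theorem MemH1.isTrace_trace (hD : IsSmoothBoundedDomain D) {u : EuclideanSpace ℝ (Fin d) → ℝ}
    (hu : MemH1 D u) : IsTrace D u (trace D u) := by
  have h := hu.exists_isTrace hD
  rw [trace, dif_pos h]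
  exact h.choose_spec

theorem tendsto_integral_norm_sq {α F : Type*} [MeasurableSpace α] [NormedAddCommGroup F]
    {μ : Measure α} {f : ℕ → α → F} {g : α → F} (hf : ∀ n, MemLp (f n) 2 μ) (hg : MemLp g 2 μ)
    (h : Tendsto (fun n => eLpNorm (fun x => f n x - g x) 2 μ) atTop (𝓝 0)) :
    Tendsto (fun n => ∫ x, ‖f n x‖ ^ 2 ∂μ) atTop (𝓝 (∫ x, ‖g x‖ ^ 2 ∂μ)) := by
  have key : ∀ {k : α → F} (hk : MemLp k 2 μ), ∫ x, ‖k x‖ ^ 2 ∂μ = ‖hk.toLp k‖ ^ 2 := by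
    intro k hk
    have h0 : 0 ≤ ∫ x, ‖k x‖ ^ 2 ∂μ := integral_nonneg fun x => by positivity
    rw [Lp.norm_toLp, hk.eLpNorm_eq_integral_rpow_norm (by norm_num) (by norm_num)]
    simp only [ENNReal.toReal_ofNat, Real.rpow_ofNat]
    rw [ENNReal.toReal_ofReal (by positivity), ← Real.rpow_natCast, ← Real.rpow_mul h0]
    simp
  simp only [key (hf _), key hg]
  exact (((Lp.tendsto_Lp_iff_tendsto_eLpNorm'' f hf g hg).2 h).norm).pow 2

/-- By density, it suffices to check the inequality for smooth functions. -/
theorem IsSmoothBoundedDomain.poincareTraceInequality_of_smooth (hD : IsSmoothBoundedDomain D)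
    {θ C : ℝ} (h : ∀ φ : EuclideanSpace ℝ (Fin d) → ℝ, ContDiff ℝ ∞ φ →
      C * ∫ x, φ x ^ 2 ∂(interiorMeasure D) ≤ ∫ x, ‖gradient φ x‖ ^ 2 ∂(interiorMeasure D) +
        θ * ∫ x, φ x ^ 2 ∂(surfaceMeasure D)) : PoincareTraceInequality D θ C := by
  intro u hu
  obtain ⟨hg, φ, hφ, h1, h2, h3⟩ := hu.isTrace_trace hD
  have t1 := tendsto_integral_norm_sq
    (fun n => hD.memLp_interiorMeasure (hφ n).continuous 2) hu.1 h1
  have t2 := tendsto_integral_norm_sq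
    (fun n => hD.memLp_interiorMeasure (continuous_gradient (hφ n)) 2) hu.memLp_weakGradient h2
  have t3 := tendsto_integral_norm_sq
    (fun n => hD.memLp_surfaceMeasure (hφ n).continuous 2) hg h3
  simp only [Real.norm_eq_abs, sq_abs] at t1 t3
  exact le_of_tendsto_of_tendsto' (t1.const_mul C) (t2.add (t3.const_mul θ)) fun n => h _ (hφ n)

end Trace

/-! ### The optimal constant -/

section Optimal

variable {d : ℕ} {D : Set (EuclideanSpace ℝ (Fin d))}

theorem isWeakGradient_const (c : ℝ) : IsWeakGradient D (fun _ => c) 0 := by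
  intro φ hφ hφc hφD v
  have hd : Continuous fun x => fderiv ℝ φ x v :=
    (hφ.continuous_fderiv (by simp)).clm_apply continuous_const
  have h0 : ∀ x ∉ D, fderiv ℝ φ x v = 0 := fun x hx => by
    have : x ∉ tsupport (fderiv ℝ φ) := fun h => hx (hφD (tsupport_fderiv_subset ℝ h))
    rw [image_eq_zero_of_notMem_tsupport this, zero_apply]
  have h1 : Integrable fun x => fderiv ℝ φ x v :=
    hd.integrable_of_hasCompactSupport (hφc.fderiv_apply ℝ v)
  have h2 := integral_mul_fderiv_eq_neg_fderiv_mul_of_integrable (μ := volume)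
    (f := fun _ : EuclideanSpace ℝ (Fin d) => (1 : ℝ)) (g := φ) (v := v) (by simp)
    (by simpa using h1) (by simpa using hφ.continuous.integrable_of_hasCompactSupport hφc)
    (fun x _ => differentiableAt_const _) (fun x _ => hφ.differentiable (by simp) x)
  rw [integral_const_mul, setIntegral_eq_integral_of_forall_compl_eq_zero h0]
  simp only [one_mul, fderiv_fun_const, Pi.zero_apply, zero_apply, zero_mul,
    integral_zero, neg_zero] at h2
  simp [h2]

/-- Weak gradients are unique up to null sets, in the case of a function with weak gradient `0`. -/
theorem IsWeakGradient.ae_eq_zero (hD : IsSmoothBoundedDomain D)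
    {u : EuclideanSpace ℝ (Fin d) → ℝ} {G : EuclideanSpace ℝ (Fin d) → EuclideanSpace ℝ (Fin d)}
    (hG : MemLp G 2 (interiorMeasure D)) (h : IsWeakGradient D u G) (h₀ : IsWeakGradient D u 0) :
    G =ᵐ[interiorMeasure D] 0 := by
  have hloc : LocallyIntegrableOn G D volume :=
    locallyIntegrableOn_of_locallyIntegrable_restrict
      (MemLp.locallyIntegrable (μ := volume.restrict D) hG (by norm_num))
  rw [interiorMeasure, EventuallyEq, ae_restrict_iff' hD.isOpen.measurableSet]
  refine hD.isOpen.ae_eq_zero_of_integral_contDiff_smul_eq_zero hloc fun φ hφ hφc hφD => ?_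
  have hint : Integrable (fun x => φ x • G x) (volume.restrict D) :=
    memLp_one_iff_integrable.1 (hG.smul (hD.memLp_interiorMeasure hφ.continuous 2))
  rw [← setIntegral_eq_integral_of_forall_compl_eq_zero (s := D) fun x hx => by
    rw [image_eq_zero_of_notMem_tsupport fun hx' => hx (hφD hx'), zero_smul]]
  refine ext_inner_right ℝ fun v => ?_
  have h1 := h φ hφ hφc hφD v
  rw [h₀ φ hφ hφc hφD v] at h1
  simp only [Pi.zero_apply, inner_zero_left, zero_mul, integral_zero, neg_zero] at h1
  rw [real_inner_comm, ← integral_inner hint, inner_zero_left, ← neg_eq_zero, h1]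
  refine congrArg _ (integral_congr_ae (Eventually.of_forall fun x => ?_))
  simp only [inner_smul_right, real_inner_comm v, mul_comm]

theorem memH1_const (hD : IsSmoothBoundedDomain D) (c : ℝ) : MemH1 D fun _ => c :=
  ⟨hD.memLp_interiorMeasure continuous_const 2, 0, MemLp.zero, isWeakGradient_const c⟩

theorem PoincareTraceInequality.mono {θ₁ θ₂ C : ℝ} (hθ : θ₁ ≤ θ₂)
    (h : PoincareTraceInequality D θ₁ C) : PoincareTraceInequality D θ₂ C := fun u hu =>
  (h u hu).trans (add_le_add_right (mul_le_mul_of_nonneg_right hθ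
    (integral_nonneg fun _ => sq_nonneg _)) _)

/-- Multiplying the inequality by `s ≤ 1` leaves the factor `s` on the gradient term, which may be
dropped. -/
theorem PoincareTraceInequality.mul_left {θ C s : ℝ} (hs₀ : 0 ≤ s) (hs₁ : s ≤ 1)
    (h : PoincareTraceInequality D θ C) : PoincareTraceInequality D (s * θ) (s * C) := fun u hu => by
  have h1 := mul_le_mul_of_nonneg_left (h u hu) hs₀
  have h2 : 0 ≤ ∫ x, ‖weakGradient D u x‖ ^ 2 ∂(interiorMeasure D) :=
    integral_nonneg fun _ => sq_nonneg _
  nlinarith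

theorem poincareTraceInequality_zero {θ : ℝ} (hθ : 0 ≤ θ) : PoincareTraceInequality D θ 0 :=
  fun u _ => by
    have h1 : 0 ≤ ∫ x, ‖weakGradient D u x‖ ^ 2 ∂(interiorMeasure D) :=
      integral_nonneg fun _ => sq_nonneg _
    have h2 : 0 ≤ ∫ x, trace D u x ^ 2 ∂(surfaceMeasure D) := integral_nonneg fun _ => sq_nonneg _
    have := mul_nonneg hθ h2
    linarith

theorem isClosed_setOf_poincareTraceInequality (θ : ℝ) :
    IsClosed {C : ℝ | PoincareTraceInequality D θ C} := by
  simp only [PoincareTraceInequality, Set.ofPred_forall]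
  exact isClosed_iInter fun u => isClosed_iInter fun _ =>
    isClosed_le (continuous_id.mul continuous_const) continuous_const

/-- Testing with `u = 1` gives `C ≤ θ ‖1‖²_∂D / ‖1‖²_D`. -/
theorem IsSmoothBoundedDomain.exists_le_mul (hD : IsSmoothBoundedDomain D) :
    ∃ K : ℝ, 0 ≤ K ∧ ∀ θ C : ℝ, PoincareTraceInequality D θ C → C ≤ θ * K := by
  have hu := memH1_const hD 1
  have hgrad : weakGradient D (fun _ => (1 : ℝ)) =ᵐ[interiorMeasure D] 0 :=
    hu.isWeakGradient_weakGradient.ae_eq_zero hD hu.memLp_weakGradient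
      (isWeakGradient_const 1)
  have hvol : 0 < volume.real D :=
    ENNReal.toReal_pos (hD.isOpen.measure_pos volume hD.isConnected.nonempty).ne'
      hD.isBounded.measure_lt_top.ne
  refine ⟨(∫ x, trace D (fun _ => (1 : ℝ)) x ^ 2 ∂(surfaceMeasure D)) / volume.real D,
    div_nonneg (integral_nonneg fun _ => sq_nonneg _) hvol.le, fun θ C h => ?_⟩
  have h1 := h _ hu
  have h2 : ∫ x, ‖weakGradient D (fun _ => (1 : ℝ)) x‖ ^ 2 ∂(interiorMeasure D) = 0 := by
    rw [integral_congr_ae (g := fun _ => (0 : ℝ)) (hgrad.mono fun x hx => by simp [hx])]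
    simp
  rw [h2, zero_add] at h1
  rw [← mul_div_assoc, le_div_iff₀ hvol]
  simpa [interiorMeasure] using h1

/-- The largest constant in the inequality with parameter `θ`. -/
noncomputable def optimalConstant (D : Set (EuclideanSpace ℝ (Fin d))) (θ : ℝ) : ℝ :=
  sSup {C : ℝ | PoincareTraceInequality D θ C}

theorem IsSmoothBoundedDomain.isGreatest_optimalConstant (hD : IsSmoothBoundedDomain D) {θ : ℝ}
    (hθ : 0 ≤ θ) : IsGreatest {C : ℝ | PoincareTraceInequality D θ C} (optimalConstant D θ) := by
  obtain ⟨K, -, hK⟩ := hD.exists_le_mul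
  have hb : BddAbove {C : ℝ | PoincareTraceInequality D θ C} := ⟨θ * K, fun C hC => hK θ C hC⟩
  exact ⟨(isClosed_setOf_poincareTraceInequality θ).csSup_mem
    ⟨0, poincareTraceInequality_zero hθ⟩ hb, fun C hC => le_csSup hb hC⟩

theorem IsSmoothBoundedDomain.monotoneOn_optimalConstant (hD : IsSmoothBoundedDomain D) :
    MonotoneOn (optimalConstant D) (Set.Ici 0) := fun _ h₁ _ h₂ h =>
  (hD.isGreatest_optimalConstant h₂).2 ((hD.isGreatest_optimalConstant h₁).1.mono h)

theorem IsSmoothBoundedDomain.mul_optimalConstant_le (hD : IsSmoothBoundedDomain D) {s θ : ℝ}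
    (hs₀ : 0 ≤ s) (hs₁ : s ≤ 1) (hθ : 0 ≤ θ) :
    s * optimalConstant D θ ≤ optimalConstant D (s * θ) :=
  (hD.isGreatest_optimalConstant (mul_nonneg hs₀ hθ)).2
    ((hD.isGreatest_optimalConstant hθ).1.mul_left hs₀ hs₁)

theorem IsSmoothBoundedDomain.optimalConstant_zero (hD : IsSmoothBoundedDomain D) :
    optimalConstant D 0 = 0 := by
  obtain ⟨K, -, hK⟩ := hD.exists_le_mul
  refine le_antisymm ?_ ((hD.isGreatest_optimalConstant le_rfl).2
    (poincareTraceInequality_zero le_rfl))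
  simpa using hK 0 _ (hD.isGreatest_optimalConstant le_rfl).1

/-- A nondecreasing function `c` on `[0, ∞)` with `s c(θ) ≤ c(s θ)` for `0 ≤ s ≤ 1` and
`c(θ) ≤ K θ` is Lipschitz with constant `K`, hence continuous: for `x ≤ y`, taking `s = x / y` gives
`c(y) - c(x) ≤ (1 - x / y) c(y) ≤ K (y - x)`. -/
theorem continuousOn_of_monotoneOn_of_mul_le {c : ℝ → ℝ} {K : ℝ} (hc : MonotoneOn c (Set.Ici 0))
    (hs : ∀ s θ, 0 ≤ s → s ≤ 1 → 0 ≤ θ → s * c θ ≤ c (s * θ)) (hK : ∀ θ, 0 ≤ θ → c θ ≤ θ * K)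
    (h₀ : c 0 = 0) : ContinuousOn c (Set.Ici 0) := by
  have hLip : ∀ x, 0 ≤ x → ∀ y, x ≤ y → c y - c x ≤ K * (y - x) := fun x hx y hxy => by
    rcases (hx.trans hxy).eq_or_lt with hy | hy
    · obtain rfl : x = y := le_antisymm hxy (hy ▸ hx)
      simp
    have h1 := hs (x / y) y (by positivity) ((div_le_one hy).2 hxy) hy.le
    rw [div_mul_cancel₀ _ hy.ne'] at h1
    have h2 : (1 - x / y) * c y ≤ (1 - x / y) * (y * K) :=
      mul_le_mul_of_nonneg_left (hK y hy.le) (by linarith [(div_le_one hy).2 hxy])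
    have h3 : (1 - x / y) * (y * K) = K * (y - x) := by field_simp
    linarith
  have hK0 : 0 ≤ K := by
    have := hc (a := 0) (b := 1) (by simp) (by simp) zero_le_one
    linarith [hK 1 zero_le_one]
  refine (LipschitzOnWith.of_dist_le_mul (K := K.toNNReal) fun x hx y hy => ?_).continuousOn
  have hx : 0 ≤ x := hx
  have hy : 0 ≤ y := hy
  rw [Real.dist_eq, Real.dist_eq, Real.coe_toNNReal K hK0]
  rcases le_total x y with h | h
  · rw [abs_sub_comm, abs_sub_comm x, abs_of_nonneg (sub_nonneg.2 (hc hx hy h)),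
      abs_of_nonneg (sub_nonneg.2 h)]
    exact hLip x hx y h
  · rw [abs_of_nonneg (sub_nonneg.2 (hc hy hx h)), abs_of_nonneg (sub_nonneg.2 h)]
    exact hLip y hy x h

end Optimal

end PoincareTrace

theorem lemma2p1 (d : ℕ) (hd : 1 ≤ d) (D : Set (EuclideanSpace ℝ (Fin d)))
    (hD : PoincareTrace.IsSmoothBoundedDomain D) :
    (∃ Cstar : ℝ → ℝ,
      (∀ θ : ℝ, 0 ≤ θ →
        IsGreatest {C : ℝ | PoincareTrace.PoincareTraceInequality D θ C} (Cstar θ)) ∧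
      (∀ θ : ℝ, 0 < θ → 0 < Cstar θ) ∧
      ContinuousOn Cstar (Set.Ici 0) ∧
      MonotoneOn Cstar (Set.Ici 0) ∧
      Cstar 0 = 0) ∧
    (∀ θ : ℝ, 0 ≤ θ →
      PoincareTrace.PoincareTraceInequality D θ
        (PoincareTrace.explicitConstant d (Metric.diam D / 2) θ)) := by
  have hexp : ∀ θ : ℝ, 0 ≤ θ → PoincareTrace.PoincareTraceInequality D θ
      (PoincareTrace.explicitConstant d (Metric.diam D / 2) θ) := fun θ hθ =>
    hD.poincareTraceInequality_of_smooth fun φ hφ => hD.smooth_explicit hd hφ hθ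
  obtain ⟨K, -, hK⟩ := hD.exists_le_mul
  refine ⟨⟨PoincareTrace.optimalConstant D, fun θ hθ => hD.isGreatest_optimalConstant hθ,
    fun θ hθ => ?_, ?_, hD.monotoneOn_optimalConstant, hD.optimalConstant_zero⟩, hexp⟩
  · exact (PoincareTrace.explicitConstant_pos hd (half_pos (hD.diam_pos hd)) hθ).trans_le
      ((hD.isGreatest_optimalConstant hθ.le).2 (hexp θ hθ.le))
  · exact PoincareTrace.continuousOn_of_monotoneOn_of_mul_le hD.monotoneOn_optimalConstant
      (fun s θ hs₀ hs₁ hθ => hD.mul_optimalConstant_le hs₀ hs₁ hθ)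
      (fun θ hθ => hK θ _ (hD.isGreatest_optimalConstant hθ).1) hD.optimalConstant_zero
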